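/- Let $\alpha,\alpha'\in\mathbb R$ and let $(p_n/q_n)_{n\ge1}$, $(p'_n/q'_n)_{n\ge1}$ be sequences of rational numbers in lowest terms ($p_n,p'_n\in\mathbb Z$, $q_n,q'_n\ge 1$), with $q_1<q_2<\cdots$, such that for all $n$ $$q_n^4\le q'_n,\qquad |q_n\alpha-p_n|\le e^{-2q'_n},\qquad |q'_n\alpha'-p'_n|\le e^{-q'_n}.$$ Put $\omega=(\alpha,\alpha',1)$ and, for $\theta\in\mathbb T^3=\mathbb R^3/\mathbb Z^3$, $$\phi(\theta)=1+\sum_{n\ge1}q_ne^{-q'_n}\cos 2\pi(q_n\theta_1-p_n\theta_3),$$ $$\tilde h(\theta)=-\sum_{n\ge1}q_n^2e^{-q'_n}\cos\bigl(2\pi q_n^2(q_n\theta_1-p_n\theta_3)\bigr)-\sum_{n\ge1}e^{-q'_n}\cos 2\pi(q'_n\theta_2-p'_n\theta_3).$$ Then these series converge, $\phi>0$, and $$\tilde H(\theta,r)=\frac{1}{\phi(\theta)}\bigl(\langle r,\omega\rangle+\tilde h(\theta)\bigr)$$ is a $C^\infty$ Hamiltonian on $\mathbb T^3\times\mathbb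 R^3$ with a complete Hamiltonian flow $\Phi^t$ (given by $\dot\theta_j=\partial_{r_j}\tilde H$, $\dot r_j=-\partial_{\theta_j}\tilde H$). This flow is topologically weakly mixing: there is a sequence of times $(t_n)$ such that for every $c\in\mathbb R$ and any two nonempty relatively open subsets $A,B$ of the energy surface $\{\tilde H=c\}$ there is $N=N(A,B)$ with $\Phi^{t_n}(A)\cap B\ne\emptyset$ for all $n\ge N$. More precisely, this holds for $t_n=e^{q'_n}$. -/

import Mathlib

open scoped ContDiff

/-- The torus `𝕋³ = ℝ³ / ℤ³`. -/
abbrev Torus3 : Type := Fin 3 → UnitAddCircle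

/-- The phase space `𝕋³ × ℝ³` of pairs (angles, actions). -/
abbrev Phase : Type := Torus3 × (Fin 3 → ℝ)

/-- The covering space `ℝ³ × ℝ³` of the phase space.  Hamiltonians are written as functions on it
that are `ℤ³`-periodic in the first factor. -/
abbrev LiftedPhase : Type := (Fin 3 → ℝ) × (Fin 3 → ℝ)

/-- The projection `ℝ³ → 𝕋³`. -/
def toTorus (θ : Fin 3 → ℝ) : Torus3 := fun j => (θ j : UnitAddCircle)

/-- The energy surface `{H = c}` in `𝕋³ × ℝ³`, for `H` periodic in the angles. -/
def energySurface (H : LiftedPhase → ℝ) (c : ℝ) : Set Phase :=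
  {z | ∃ θ : Fin 3 → ℝ, toTorus θ = z.1 ∧ H (θ, z.2) = c}

/-- `γ : ℝ → ℝ³ × ℝ³` solves Hamilton's equations `θ̇ⱼ = ∂H/∂rⱼ`, `ṙⱼ = -∂H/∂θⱼ` for all times. -/
def SolvesHamilton (H : LiftedPhase → ℝ) (γ : ℝ → LiftedPhase) : Prop :=
  ∀ (t : ℝ) (j : Fin 3),
    HasDerivAt (fun s => (γ s).1 j) (fderiv ℝ H (γ t) (0, Pi.single j 1)) t ∧
    HasDerivAt (fun s => (γ s).2 j) (-fderiv ℝ H (γ t) (Pi.single j 1, 0)) t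

/-- `Φ` is the (complete) Hamiltonian flow of `H` on `𝕋³ × ℝ³`: through every initial point there is
a solution of Hamilton's equations defined for all times, and `Φᵗ` moves the point along it. -/
def IsHamiltonianFlow (H : LiftedPhase → ℝ) (Φ : ℝ → Phase → Phase) : Prop :=
  ∀ θ₀ r₀ : Fin 3 → ℝ, ∃ γ : ℝ → LiftedPhase,
    γ 0 = (θ₀, r₀) ∧ SolvesHamilton H γ ∧
      ∀ t : ℝ, Φ t (toTorus θ₀, r₀) = (toTorus (γ t).1, (γ t).2)

/-- `A` is a relatively open subset of `E`. -/
def IsRelOpen (E A : Set Phase) : Prop := ∃ U : Set Phase, IsOpen U ∧ A = E ∩ U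

/-- For any two nonempty open sets `A`, `B` on the same energy surface of `H`, the image `Φ^{tₙ}(A)`
meets `B` for all large `n`. -/
def WeaklyMixingAlong (H : LiftedPhase → ℝ) (Φ : ℝ → Phase → Phase) (t : ℕ → ℝ) : Prop :=
  ∀ (c : ℝ) (A B : Set Phase),
    IsRelOpen (energySurface H c) A → IsRelOpen (energySurface H c) B →
    A.Nonempty → B.Nonempty →
      ∃ N : ℕ, ∀ n ≥ N, ((Φ (t n) '' A) ∩ B).Nonempty

/-- Topological weak mixing of the flow `Φ` of `H`. -/
def TopologicallyWeaklyMixing (H : LiftedPhase → ℝ) (Φ : ℝ → Phase → Phase) : Prop :=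
  ∃ t : ℕ → ℝ, WeaklyMixingAlong H Φ t

/-- The `n`-th term `qₙ e^{-q'ₙ} cos 2π(qₙθ₁ - pₙθ₃)` of `φ`. -/
noncomputable def phiTerm (p : ℕ → ℤ) (q q' : ℕ → ℕ) (n : ℕ) (θ : Fin 3 → ℝ) : ℝ :=
  q n * Real.exp (-(q' n : ℝ)) * Real.cos (2 * Real.pi * (q n * θ 0 - p n * θ 2))

/-- `φ(θ) = 1 + ∑ₙ qₙ e^{-q'ₙ} cos 2π(qₙθ₁ - pₙθ₃)`. -/
noncomputable def phi (p : ℕ → ℤ) (q q' : ℕ → ℕ) (θ : Fin 3 → ℝ) : ℝ :=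
  1 + ∑' n, phiTerm p q q' n θ

/-- `h̃ₙ(θ) = κₙ e^{-q'ₙ} cos 2πκₙ(qₙθ₁ - pₙθ₃)` with `κₙ = qₙ²`. -/
noncomputable def hTerm (p : ℕ → ℤ) (q q' : ℕ → ℕ) (n : ℕ) (θ : Fin 3 → ℝ) : ℝ :=
  (q n : ℝ) ^ 2 * Real.exp (-(q' n : ℝ)) *
    Real.cos (2 * Real.pi * (q n : ℝ) ^ 2 * (q n * θ 0 - p n * θ 2))

/-- `h̃'ₙ(θ) = e^{-q'ₙ} cos 2π(q'ₙθ₂ - p'ₙθ₃)`. -/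
noncomputable def hTerm' (p' : ℕ → ℤ) (q' : ℕ → ℕ) (n : ℕ) (θ : Fin 3 → ℝ) : ℝ :=
  Real.exp (-(q' n : ℝ)) * Real.cos (2 * Real.pi * (q' n * θ 1 - p' n * θ 2))

/-- `h̃ = -∑ₙ h̃ₙ - ∑ₙ h̃'ₙ`. -/
noncomputable def tildeh (p p' : ℕ → ℤ) (q q' : ℕ → ℕ) (θ : Fin 3 → ℝ) : ℝ :=
  -(∑' n, hTerm p q q' n θ) - ∑' n, hTerm' p' q' n θ

/-- The frequency vector `ω = (α, α', 1)`. -/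
def freq (α α' : ℝ) : Fin 3 → ℝ := ![α, α', 1]

/-- The Hamiltonian `H̃(θ, r) = (⟨r, ω⟩ + h̃(θ)) / φ(θ)`, on the covering space. -/
noncomputable def tildeH (α α' : ℝ) (p p' : ℕ → ℤ) (q q' : ℕ → ℕ) (z : LiftedPhase) : ℝ :=
  ((∑ j, z.2 j * freq α α' j) + tildeh p p' q q' z.1) / phi p q q' z.1

theorem cos_int_shift (x y : ℝ) (k : ℤ) (h : y = x + k * (2 * Real.pi)) :
    Real.cos y = Real.cos x := by
  rw [h, Real.cos_add_int_mul_two_pi]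

/-- `H̃` is `ℤ³`-periodic in the angles, hence a function on `𝕋³ × ℝ³`. -/
theorem tildeH_periodic (α α' : ℝ) (p p' : ℕ → ℤ) (q q' : ℕ → ℕ) (θ r : Fin 3 → ℝ)
    (k : Fin 3 → ℤ) :
    tildeH α α' p p' q q' (fun j => θ j + k j, r) = tildeH α α' p p' q q' (θ, r) := by
  have h1 : ∀ n, phiTerm p q q' n (fun j => θ j + k j) = phiTerm p q q' n θ := fun n => by
    unfold phiTerm
    exact congrArg _ (cos_int_shift _ _ (q n * k 0 - p n * k 2) (by push_cast; ring))
  have h2 : ∀ n, hTerm p q q' n (fun j => θ j + k j) = hTerm p q q' n θ := fun n => by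
    unfold hTerm
    exact congrArg _ (cos_int_shift _ _ ((q n : ℤ) ^ 2 * (q n * k 0 - p n * k 2)) (by push_cast; ring))
  have h3 : ∀ n, hTerm' p' q' n (fun j => θ j + k j) = hTerm' p' q' n θ := fun n => by
    unfold hTerm'
    exact congrArg _ (cos_int_shift _ _ (q' n * k 1 - p' n * k 2) (by push_cast; ring))
  simp only [tildeH, tildeh, phi, h1, h2, h3]

/-!
On the energy surface `{H̃ = c}` one has `⟨r, ω⟩ = cφ - h̃`, so Hamilton's equations become
`θ̇ = ω / φ` and `ṙ = ∇(cφ - h̃) / φ`.  After the time change `dt = φ ds` the angles move along the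
straight line `θ + sω`, the length `s` covered at time `t` is given by `∫₀ˢ φ(θ + uω) du = t`, and
the actions are obtained by integrating `∇(cφ - h̃)` along the line
(`LiouvillePair.flow_travelTime`).  All these integrals are sums over the resonances `n` of
oscillatory integrals `∫₀ˢ cos 2π(x + δₙu) du` with `δₙ = qₙα - pₙ` or `δ'ₙ = q'ₙα' - p'ₙ`.

At time `tₙ = e^{q'ₙ}` only the `n`-th resonance in `(θ₁, θ₃)` is visible
(`LiouvillePair.abs_hasSum_sub_le`): the earlier ones average out because
`|qₖα - pₖ| ≥ 1 / (2qₙ)` for `k < n`, the later ones have tiny amplitudes.  The energy surface is a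
graph over `(θ, r₁, r₂)`, and a starting point in a given open set that arrives near a given target
is found with three successive choices.

* As `θ₁` runs through a half-wave of length `1 / (2qₙ)`, the length `s` runs through an interval
  of length comparable to `qₙ` (`LiouvillePair.exists_advance_add_le`).  Since `α, α', 1` are
  rationally independent, the linear flow is minimal, and some `s` in this interval brings the
  angles near the target (`exists_syndetic_linearFlow`).
* As `θ₁` runs through a window of length `2 / qₙ³`, `s` changes by `O(1 / qₙ)` only, while the
  displacement of `r₁` oscillates with amplitude at least `qₙ⁵`, up to an error `O(qₙ²)`
  (`LiouvillePair.exists_integral_levelForce_zero_eq`).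
* Neither `s` nor `r₁` depends on `θ₂`.  The displacement of `r₂` is a sum of waves in `θ₂` of
  frequencies `q'ₖ`.  The `n`-th of them may be negligible, since `δ'ₙ tₙ` can be
  equal or very close to `±1`.  Instead, a
  fixed index `K` with `q'_K` large is used: the target is moved slightly, so that the `K`-th wave
  arrives out of phase and has an amplitude of at least the order of `q'_K`.  The frequencies are
  lacunary, hence `θ₂` can be chosen such that all waves with an index in a range that contains `K`
  have the same sign (`LiouvillePair.exists_le_integral_levelForce_one`).
-/

open scoped Matrix Topology
open Real Filter

/-! ### Trigonometric series and oscillatory integrals -/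

/-- The trigonometric series `∑ₙ aₙ cos 2π(⟨mₙ, θ⟩ + β)`.  The common phase `β` makes the class of
these series stable under partial derivatives. -/
noncomputable def trigSeries (a : ℕ → ℝ) (m : ℕ → Fin 3 → ℝ) (β : ℝ) (θ : Fin 3 → ℝ) : ℝ :=
  ∑' n, a n * cos (2 * π * (m n ⬝ᵥ θ + β))

/-- The amplitudes `aₙ` decay faster than any power of the frequencies `mₙ`. -/
def RapidDecay (a : ℕ → ℝ) (m : ℕ → Fin 3 → ℝ) : Prop :=
  ∀ N : ℕ, Summable fun n => |a n| * (1 + ∑ j, |m n j|) ^ N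

/-- The oscillatory integral `∫₀ˢ cos 2π(x + δu) du`. -/
noncomputable def osc (x δ s : ℝ) : ℝ := ∫ u in (0 : ℝ)..s, cos (2 * π * (x + δ * u))

section TrigSeries

variable {a : ℕ → ℝ} {m : ℕ → Fin 3 → ℝ}

theorem RapidDecay.summable (h : RapidDecay a m) : Summable fun n => |a n| := by
  simpa using h 0

theorem RapidDecay.summable_term (h : RapidDecay a m) (β : ℝ) (θ : Fin 3 → ℝ) :
    Summable fun n => a n * cos (2 * π * (m n ⬝ᵥ θ + β)) := by
  refine Summable.of_norm_bounded h.summable fun n => ?_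
  rw [norm_mul, norm_eq_abs, norm_eq_abs]
  exact mul_le_of_le_one_right (abs_nonneg _) (abs_cos_le_one _)

theorem RapidDecay.partialDeriv (h : RapidDecay a m) (j : Fin 3) :
    RapidDecay (fun n => 2 * π * a n * m n j) m := by
  intro N
  refine Summable.of_nonneg_of_le (fun n => by positivity) (fun n => ?_)
    ((h (N + 1)).mul_left (2 * π))
  have h1 : |m n j| ≤ 1 + ∑ j, |m n j| := by
    have := Finset.single_le_sum (f := fun j => |m n j|) (fun i _ => abs_nonneg _)
      (Finset.mem_univ j)
    linarith
  rw [abs_mul, abs_mul, abs_of_pos two_pi_pos, pow_succ]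
  calc 2 * π * |a n| * |m n j| * (1 + ∑ j, |m n j|) ^ N
      ≤ 2 * π * |a n| * (1 + ∑ j, |m n j|) * (1 + ∑ j, |m n j|) ^ N := by gcongr
    _ = _ := by ring

/-- The partial derivatives of a trigonometric series are trigonometric series, with the phase
shifted by a quarter turn. -/
theorem hasFDerivAt_trigSeries (h : RapidDecay a m) (β : ℝ) (θ : Fin 3 → ℝ) :
    HasFDerivAt (trigSeries a m β)
      (∑ j, trigSeries (fun n => 2 * π * a n * m n j) m (β + 1 / 4) θ •
        ContinuousLinearMap.proj (R := ℝ) (φ := fun _ : Fin 3 => ℝ) j) θ := by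
  set f' : ℕ → (Fin 3 → ℝ) → ((Fin 3 → ℝ) →L[ℝ] ℝ) := fun n θ =>
    ∑ j, (2 * π * a n * m n j * cos (2 * π * (m n ⬝ᵥ θ + (β + 1 / 4)))) •
        ContinuousLinearMap.proj (R := ℝ) (φ := fun _ : Fin 3 => ℝ) j with hf'
  have hterm : ∀ n θ, HasFDerivAt (fun θ => a n * cos (2 * π * (m n ⬝ᵥ θ + β))) (f' n θ) θ := by
    intro n θ
    have hlin : HasFDerivAt (fun θ : Fin 3 → ℝ => m n ⬝ᵥ θ)
        (∑ j, m n j • ContinuousLinearMap.proj (R := ℝ) (φ := fun _ : Fin 3 => ℝ) j) θ := by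
      have := (∑ j, m n j • ContinuousLinearMap.proj (R := ℝ)
        (φ := fun _ : Fin 3 => ℝ) j).hasFDerivAt (x := θ)
      refine this.congr_of_eventuallyEq (Eventually.of_forall fun x => ?_)
      simp [dotProduct]
    have h2 := (((hlin.add_const β).const_mul (2 * π)).cos).const_mul (a n)
    refine h2.congr_fderiv ?_
    have hs : cos (2 * π * (m n ⬝ᵥ θ + (β + 1 / 4))) = - sin (2 * π * (m n ⬝ᵥ θ + β)) := by
      rw [← cos_add_pi_div_two]; ring_nf
    simp only [hf', hs, Finset.smul_sum, smul_smul]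
    refine Finset.sum_congr rfl fun j _ => ?_
    congr 1
    ring
  have hbound : ∀ n θ, ‖f' n θ‖ ≤ 2 * π * (|a n| * (1 + ∑ j, |m n j|) ^ 1) := by
    intro n θ
    have hproj : ∀ j, ‖ContinuousLinearMap.proj (R := ℝ) (φ := fun _ : Fin 3 => ℝ) j‖ ≤ 1 :=
      fun j => ContinuousLinearMap.opNorm_le_bound _ zero_le_one fun x => by
        simpa using norm_le_pi_norm x j
    calc ‖f' n θ‖ ≤ ∑ j, 2 * π * |a n| * |m n j| := by
          refine norm_sum_le_of_le _ fun j _ => ?_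
          rw [norm_smul, norm_eq_abs, abs_mul, abs_mul, abs_mul, abs_of_pos two_pi_pos]
          have := abs_cos_le_one (2 * π * (m n ⬝ᵥ θ + (β + 1 / 4)))
          calc _ ≤ 2 * π * |a n| * |m n j| * 1 * 1 := by
                gcongr
                exact hproj j
            _ = _ := by ring
      _ = 2 * π * (|a n| * ∑ j, |m n j|) := by rw [← Finset.mul_sum]; ring
      _ ≤ _ := by rw [pow_one]; gcongr; linarith
  have key := hasFDerivAt_tsum ((h 1).mul_left (2 * π)) hterm hbound (h.summable_term β θ) θ
  refine key.congr_fderiv ?_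
  have hsum : HasSum (fun n => f' n θ)
      (∑ j, trigSeries (fun n => 2 * π * a n * m n j) m (β + 1 / 4) θ •
        ContinuousLinearMap.proj (R := ℝ) (φ := fun _ : Fin 3 => ℝ) j) :=
    hasSum_sum fun j _ =>
      ((h.partialDeriv j).summable_term (β + 1 / 4) θ).hasSum.smul_const _
  exact hsum.tsum_eq

theorem contDiff_trigSeries (h : RapidDecay a m) (β : ℝ) : ContDiff ℝ ∞ (trigSeries a m β) := by
  rw [contDiff_infty]
  intro N
  induction N generalizing a β with
  | zero =>
    exact contDiff_zero.2 (continuous_iff_continuousAt.2 fun θ =>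
      (hasFDerivAt_trigSeries h β θ).continuousAt)
  | succ N ih =>
    push_cast
    rw [contDiff_succ_iff_fderiv]
    refine ⟨fun θ => (hasFDerivAt_trigSeries h β θ).differentiableAt, fun hN => ?_, ?_⟩
    · exact absurd hN (by simp)
    · rw [funext fun θ => (hasFDerivAt_trigSeries h β θ).fderiv]
      exact ContDiff.sum fun j _ => (ih (h.partialDeriv j) _).smul contDiff_const

theorem continuous_trigSeries (h : RapidDecay a m) (β : ℝ) : Continuous (trigSeries a m β) :=
  (contDiff_trigSeries h β).continuous

theorem hasSum_integral_trigSeries (h : RapidDecay a m) (β : ℝ) (θ w : Fin 3 → ℝ) (s : ℝ) :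
    HasSum (fun n => a n * osc (m n ⬝ᵥ θ + β) (m n ⬝ᵥ w) s)
      (∫ u in (0 : ℝ)..s, trigSeries a m β (θ + u • w)) := by
  let f : ℕ → C(ℝ, ℝ) := fun n =>
    ⟨fun u => a n * cos (2 * π * (m n ⬝ᵥ (θ + u • w) + β)), by
      simp only [dotProduct_add, dotProduct_smul]; fun_prop⟩
  have hf : Summable fun n => ‖(f n).restrict
      (⟨Set.uIcc 0 s, isCompact_uIcc⟩ : TopologicalSpace.Compacts ℝ)‖ := by
    refine Summable.of_nonneg_of_le (fun n => norm_nonneg _) (fun n => ?_) h.summable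
    refine (ContinuousMap.norm_le _ (abs_nonneg _)).2 fun x => ?_
    simp only [f, ContinuousMap.restrict_apply, ContinuousMap.coe_mk, norm_mul, norm_eq_abs]
    exact mul_le_of_le_one_right (abs_nonneg _) (abs_cos_le_one _)
  have key := intervalIntegral.hasSum_intervalIntegral_of_summable_norm hf
  have hterm : ∀ n, a n * osc (m n ⬝ᵥ θ + β) (m n ⬝ᵥ w) s = ∫ x in (0 : ℝ)..s, f n x := ?_
  · rw [funext hterm]
    exact key
  intro n
  rw [osc, ← intervalIntegral.integral_const_mul]
  congr 1
  ext u
  simp only [f, ContinuousMap.coe_mk]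
  rw [dotProduct_add, dotProduct_smul, smul_eq_mul]
  ring_nf

end TrigSeries

section Osc

theorem continuous_cos_phase (x δ : ℝ) : Continuous fun u : ℝ => cos (2 * π * (x + δ * u)) := by
  fun_prop

theorem abs_osc_le (x δ : ℝ) {s : ℝ} (hs : 0 ≤ s) : |osc x δ s| ≤ s := by
  have := intervalIntegral.norm_integral_le_of_norm_le_const (a := 0) (b := s) (C := 1)
    (f := fun u => cos (2 * π * (x + δ * u))) fun u _ => abs_cos_le_one _
  simpa [osc, abs_of_nonneg hs] using this

theorem osc_eq {δ : ℝ} (hδ : δ ≠ 0) (x s : ℝ) :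
    osc x δ s = sin (π * (δ * s)) / (π * δ) * cos (2 * π * (x + δ * s / 2)) := by
  have hd : ∀ u ∈ Set.uIcc 0 s, HasDerivAt (fun u => sin (2 * π * (x + δ * u)) / (2 * π * δ))
      (cos (2 * π * (x + δ * u))) u := by
    intro u _
    have h1 : HasDerivAt (fun u => 2 * π * (x + δ * u)) (2 * π * δ) u := by
      simpa using (((hasDerivAt_id u).const_mul δ).const_add x).const_mul (2 * π)
    have h2 := h1.sin.div_const (2 * π * δ)
    refine h2.congr_deriv ?_
    field_simp
  rw [osc, intervalIntegral.integral_eq_sub_of_hasDerivAt hd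
    ((continuous_cos_phase x δ).intervalIntegrable _ _), ← sub_div, sin_sub_sin]
  have e1 : (2 * π * (x + δ * s) - 2 * π * (x + δ * 0)) / 2 = π * (δ * s) := by ring
  have e2 : (2 * π * (x + δ * s) + 2 * π * (x + δ * 0)) / 2 = 2 * π * (x + δ * s / 2) := by ring
  rw [e1, e2]
  field_simp

theorem abs_osc_le_inv {δ : ℝ} (hδ : δ ≠ 0) (x s : ℝ) : |osc x δ s| ≤ 1 / (π * |δ|) := by
  rw [osc_eq hδ, abs_mul, abs_div, abs_mul, abs_of_pos pi_pos]
  calc _ ≤ 1 / (π * |δ|) * 1 := by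
        gcongr
        · exact abs_sin_le_one _
        · exact abs_cos_le_one _
    _ = _ := mul_one _

/-- Over less than a sixth of a turn the integrand stays above `1 / 2`. -/
theorem half_le_osc_int (k : ℤ) {δ s : ℝ} (hs : 0 ≤ s) (h : |δ| * s ≤ 1 / 6) :
    s / 2 ≤ osc k δ s := by
  have h1 : ∫ _ in (0 : ℝ)..s, (1 / 2 : ℝ) ≤ osc k δ s := by
    refine intervalIntegral.integral_mono_on hs (by simp)
      ((continuous_cos_phase _ δ).intervalIntegrable _ _) fun u hu => ?_
    have e : 2 * π * (k + δ * u) = 2 * π * (δ * u) + k * (2 * π) := by ring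
    rw [e, cos_add_int_mul_two_pi, ← cos_abs, ← cos_pi_div_three]
    have hu' : |δ * u| ≤ 1 / 6 := by
      rw [abs_mul, abs_of_nonneg hu.1]
      exact (mul_le_mul_of_nonneg_left hu.2 (abs_nonneg _)).trans h
    have : |2 * π * (δ * u)| ≤ π / 3 := by
      rw [abs_mul, abs_of_pos two_pi_pos]
      nlinarith [pi_pos]
    exact cos_le_cos_of_nonneg_of_le_pi (abs_nonneg _) (by linarith [pi_pos]) this
  simpa [mul_comm, div_eq_mul_inv] using h1

theorem osc_add_half (x δ s : ℝ) : osc (x + 1 / 2) δ s = -osc x δ s := by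
  rw [osc, osc, ← intervalIntegral.integral_neg]
  congr 1
  ext u
  rw [← cos_add_pi]
  ring_nf

/-- A shift of the phase reproduces the same kind of integral, with a small factor. -/
theorem osc_add_sub_osc (x h δ s : ℝ) :
    osc (x + h) δ s - osc x δ s = 2 * sin (π * h) * osc (x + h / 2 + 1 / 4) δ s := by
  rw [osc, osc, osc, ← intervalIntegral.integral_sub
    ((continuous_cos_phase _ δ).intervalIntegrable _ _)
    ((continuous_cos_phase _ δ).intervalIntegrable _ _), ← intervalIntegral.integral_const_mul]
  congr 1
  ext u
  have e : cos (2 * π * (x + h / 2 + 1 / 4 + δ * u)) = -sin (2 * π * (x + h / 2 + δ * u)) := by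
    rw [← cos_add_pi_div_two]; ring_nf
  rw [e, cos_sub_cos]
  ring_nf

theorem abs_osc_add_sub_osc_le (x h δ s : ℝ) :
    |osc (x + h) δ s - osc x δ s| ≤ 2 * π * |h| * |osc (x + h / 2 + 1 / 4) δ s| := by
  rw [osc_add_sub_osc, abs_mul, abs_mul, abs_two]
  have : |sin (π * h)| ≤ π * |h| := by
    refine (abs_sin_le_abs).trans_eq ?_
    rw [abs_mul, abs_of_pos pi_pos]
  gcongr ?_ * _
  linarith

end Osc

/-! ### Arithmetic of the approximations -/

/-- The arithmetic hypotheses on the two frequencies: `α` and `α'` are Liouville numbers with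
intertwined rational approximations in lowest terms. -/
structure LiouvillePair (α α' : ℝ) (p p' : ℕ → ℤ) (q q' : ℕ → ℕ) : Prop where
  pos : ∀ n, 1 ≤ q n
  pos' : ∀ n, 1 ≤ q' n
  coprime : ∀ n, IsCoprime (p n) (q n : ℤ)
  coprime' : ∀ n, IsCoprime (p' n) (q' n : ℤ)
  mono : StrictMono q
  pow_le : ∀ n, q n ^ 4 ≤ q' n
  approx : ∀ n, |q n * α - p n| ≤ exp (-(2 * q' n : ℝ))
  approx' : ∀ n, |q' n * α' - p' n| ≤ exp (-(q' n : ℝ))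

theorem one_le_abs_mul_sub_mul {a c : ℤ} {b d : ℕ} (h : IsCoprime a (b : ℤ))
    (h' : IsCoprime c (d : ℤ)) (hne : b ≠ d) : (1 : ℝ) ≤ |(a : ℝ) * d - c * b| := by
  have : a * d - c * b ≠ 0 := by
    intro h0
    have h1 : a * (d : ℤ) = c * b := by linarith
    have hbd : (b : ℤ) ∣ d := h.symm.dvd_of_dvd_mul_left (h1 ▸ Dvd.intro_left c rfl)
    have hdb : (d : ℤ) ∣ b := h'.symm.dvd_of_dvd_mul_left (h1 ▸ Dvd.intro_left a rfl)
    exact hne (Nat.dvd_antisymm (Int.natCast_dvd_natCast.1 hbd) (Int.natCast_dvd_natCast.1 hdb))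
  exact_mod_cast Int.one_le_abs this

theorem mul_exp_neg_le_half (x : ℝ) : x * exp (-x) ≤ 1 / 2 := by
  have h1 : 2 * x ≤ exp x := by
    have h2 := add_one_le_exp (x / 2)
    have h3 : exp x = exp (x / 2) ^ 2 := by rw [← exp_nat_mul]; ring_nf
    rcases le_or_gt x 0 with hx | hx
    · exact (by linarith : 2 * x ≤ 0).trans (exp_pos x).le
    · rw [h3]; nlinarith [sq_nonneg (x / 2 - 1)]
  rw [exp_neg, ← div_eq_mul_inv, div_le_iff₀ (exp_pos x)]
  linarith

/-- The constant that bounds the contribution of the nonresonant terms, see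
`LiouvillePair.abs_hasSum_sub_le`. -/
noncomputable def nonresonantBound (q' : ℕ → ℕ) : ℝ :=
  ∑' k, 3 * ((q' k : ℝ) ^ 2 * exp (-(q' k : ℝ) / 2))

namespace LiouvillePair

variable {α α' : ℝ} {p p' : ℕ → ℤ} {q q' : ℕ → ℕ} (h : LiouvillePair α α' p p' q q')
include h

theorem one_le (n : ℕ) : (1 : ℝ) ≤ q n := by exact_mod_cast h.pos n

theorem one_le' (n : ℕ) : (1 : ℝ) ≤ q' n := by exact_mod_cast h.pos' n

theorem pow_four_le (n : ℕ) : (q n : ℝ) ^ 4 ≤ q' n := by exact_mod_cast h.pow_le n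

theorem add_one_le (n : ℕ) : (n : ℝ) + 1 ≤ q n := by
  have : n + 1 ≤ q n := by
    induction n with
    | zero => exact h.pos 0
    | succ n ih => exact ih.trans_lt (h.mono n.lt_succ_self)
  exact_mod_cast this

theorem pow_le_of_le_four (n : ℕ) {k : ℕ} (hk : k ≤ 4) : (q n : ℝ) ^ k ≤ q' n :=
  (pow_le_pow_right₀ (h.one_le n) hk).trans (h.pow_four_le n)

theorem le' (n : ℕ) : (q n : ℝ) ≤ q' n := by
  simpa using h.pow_le_of_le_four n (k := 1) (by norm_num)

theorem tendsto_q : Tendsto (fun n => (q n : ℝ)) atTop atTop :=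
  tendsto_natCast_atTop_atTop.comp h.mono.tendsto_atTop

theorem tendsto_q' : Tendsto (fun n => (q' n : ℝ)) atTop atTop :=
  tendsto_atTop_mono h.le' h.tendsto_q

/-- Sums over resonances are compared with this series: the factor `e^{-q'ₙ / 2}` is what remains of
`e^{-q'ₙ}` after integration over times of order at most `e^{q'ₙ / 2}`. -/
theorem summable_weight (N : ℕ) : Summable fun n => (q' n : ℝ) ^ N * exp (-(q' n : ℝ) / 2) := by
  have hs : Summable fun n : ℕ => ((n : ℝ) + 1) ^ (-2 : ℤ) := by
    have := (summable_nat_add_iff 1).2 (Real.summable_one_div_nat_pow.2 (by norm_num : 1 < 2))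
    refine this.congr fun n => ?_
    push_cast
    rw [zpow_neg, one_div]
    norm_cast
  refine Summable.of_nonneg_of_le (fun n => by positivity) (fun n => ?_)
    (hs.mul_left ((2 : ℝ) ^ (N + 2) * (N + 2).factorial))
  have hx : (0 : ℝ) < q' n := zero_lt_one.trans_le (h.one_le' n)
  have h1 := Real.pow_div_factorial_le_exp (x := (q' n : ℝ) / 2) (by positivity) (N + 2)
  rw [div_le_iff₀ (by positivity), div_pow, div_le_iff₀ (by positivity), pow_add] at h1
  have h2 : (n : ℝ) + 1 ≤ q' n := (h.add_one_le n).trans (h.le' n)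
  have h3 : exp ((q' n : ℝ) / 2) * exp (-(q' n : ℝ) / 2) = 1 := by
    rw [← exp_add]; ring_nf; exact exp_zero
  have h4 : ((n : ℝ) + 1) ^ 2 ≤ (q' n : ℝ) ^ 2 := by gcongr
  rw [zpow_neg, ← div_eq_mul_inv, le_div_iff₀ (by positivity)]
  calc (q' n : ℝ) ^ N * exp (-(q' n : ℝ) / 2) * ((n : ℝ) + 1) ^ (2 : ℤ)
      = (q' n : ℝ) ^ N * ((n : ℝ) + 1) ^ 2 * exp (-(q' n : ℝ) / 2) := by rw [zpow_ofNat]; ring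
    _ ≤ (q' n : ℝ) ^ N * (q' n : ℝ) ^ 2 * exp (-(q' n : ℝ) / 2) := by gcongr
    _ ≤ (exp ((q' n : ℝ) / 2) * (N + 2).factorial * 2 ^ (N + 2)) * exp (-(q' n : ℝ) / 2) := by
        gcongr
    _ = 2 ^ (N + 2) * (N + 2).factorial *
          (exp ((q' n : ℝ) / 2) * exp (-(q' n : ℝ) / 2)) := by ring
    _ = _ := by rw [h3, mul_one]

/-- Distinct fractions in lowest terms repel each other: `α` is not too close to the earlier
fractions because it is very close to the `n`-th one. -/
theorem one_le_separation {k n : ℕ} (hkn : k < n) :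
    1 ≤ q n * |q k * α - p k| + q k * |q n * α - p n| := by
  have h1 := one_le_abs_mul_sub_mul (h.coprime k) (h.coprime n) (h.mono hkn).ne
  refine h1.trans ?_
  have e : (p k : ℝ) * q n - p n * q k = q k * (q n * α - p n) - q n * (q k * α - p k) := by ring
  rw [e]
  refine (abs_sub _ _).trans_eq ?_
  rw [abs_mul, abs_mul, Nat.abs_cast, Nat.abs_cast, add_comm]

theorem half_le_mul_approx {k n : ℕ} (hkn : k < n) : 1 / 2 ≤ q n * |q k * α - p k| := by
  have h1 := h.one_le_separation hkn
  have h2 : (q k : ℝ) * |q n * α - p n| ≤ 1 / 2 := by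
    refine le_trans ?_ (mul_exp_neg_le_half (q n : ℝ))
    have hk : (q k : ℝ) ≤ q n := by exact_mod_cast (h.mono hkn).le
    have : exp (-(2 * q' n : ℝ)) ≤ exp (-(q n : ℝ)) := by
      apply exp_le_exp.2
      linarith [h.le' n, h.one_le n]
    gcongr
    exact (h.approx n).trans this
  linarith

theorem approx_ne_zero (k : ℕ) : (q k : ℝ) * α - p k ≠ 0 := by
  intro h0
  have := h.half_le_mul_approx k.lt_succ_self
  rw [h0] at this
  norm_num at this

/-- The denominators `q'` are lacunary, because `qₙ ≥ e^{2q'ₖ} / 2` for `k < n`. -/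
theorem six_mul_le {k n : ℕ} (hkn : k < n) : 6 * (q' k : ℝ) ≤ q' n := by
  have h1 := h.half_le_mul_approx hkn
  have h2 : 1 / 2 ≤ q n * exp (-(2 * q' k : ℝ)) :=
    h1.trans (by gcongr; exact h.approx k)
  rw [exp_neg, ← div_eq_mul_inv, le_div_iff₀ (exp_pos _)] at h2
  have h3 := add_one_le_exp (2 * q' k : ℝ)
  have h4 : (2 : ℝ) ≤ q n := by
    exact_mod_cast (h.pos k).trans_lt (h.mono hkn)
  have h5 : (8 : ℝ) * q n ≤ q n ^ 4 := by
    have : (2 : ℝ) ^ 3 ≤ q n ^ 3 := by gcongr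
    nlinarith
  linarith [h.pow_four_le n]

theorem half_le_mul_approx' {k n : ℕ} (hkn : k < n) : 1 / 2 ≤ q' n * |q' k * α' - p' k| := by
  have hlt : (q' k : ℝ) < q' n := by linarith [h.six_mul_le hkn, h.one_le' k]
  have h1 := one_le_abs_mul_sub_mul (h.coprime' k) (h.coprime' n) (by exact_mod_cast hlt.ne)
  have h2 : (q' k : ℝ) * |q' n * α' - p' n| ≤ 1 / 2 := by
    refine le_trans ?_ (mul_exp_neg_le_half (q' n : ℝ))
    gcongr
    exact h.approx' n
  have e : (p' k : ℝ) * q' n - p' n * q' k =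
    q' k * (q' n * α' - p' n) - q' n * (q' k * α' - p' k) := by ring
  rw [e] at h1
  have h3 := h1.trans (abs_sub _ _)
  rw [abs_mul, abs_mul, Nat.abs_cast, Nat.abs_cast] at h3
  linarith

theorem approx_ne_zero' (k : ℕ) : (q' k : ℝ) * α' - p' k ≠ 0 := by
  intro h0
  have := h.half_le_mul_approx' k.lt_succ_self
  rw [h0] at this
  norm_num at this

/-- The frequencies `α, α', 1` are rationally independent. -/
theorem int_combination_ne_zero (m : Fin 3 → ℤ) (hm : m ≠ 0) :
    (m 0 : ℝ) * α + m 1 * α' + m 2 ≠ 0 := by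
  intro h0
  apply hm
  -- Multiplying the relation by `qₙ q'ₙ` gives an integer that tends to zero.
  have hint : ∀ᶠ n in atTop, m 0 * q' n * p n + m 1 * q n * p' n + m 2 * q n * q' n = (0 : ℤ) := by
    have hw := (h.summable_weight 1).tendsto_atTop_zero
    have hw2 := hw.const_mul (|(m 0 : ℝ)| + |(m 1 : ℝ)|)
    rw [mul_zero] at hw2
    filter_upwards [hw2.eventually (gt_mem_nhds (zero_lt_one' ℝ))] with n hn
    have hx := h.one_le' n
    have e : ((m 0 * q' n * p n + m 1 * q n * p' n + m 2 * q n * q' n : ℤ) : ℝ) =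
        -(m 0 * (q' n * (q n * α - p n)) + m 1 * (q n * (q' n * α' - p' n))) := by
      push_cast
      linear_combination (q n : ℝ) * q' n * h0
    have h1 : (q' n : ℝ) * |q n * α - p n| ≤ (q' n : ℝ) ^ 1 * exp (-(q' n : ℝ) / 2) := by
      rw [pow_one]
      gcongr
      exact (h.approx n).trans (exp_le_exp.2 (by linarith))
    have h2 : (q n : ℝ) * |q' n * α' - p' n| ≤ (q' n : ℝ) ^ 1 * exp (-(q' n : ℝ) / 2) := by
      rw [pow_one]
      gcongr
      · exact_mod_cast h.le' n
      · exact (h.approx' n).trans (exp_le_exp.2 (by linarith))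
    rw [← Int.abs_lt_one_iff]
    have : |((m 0 * q' n * p n + m 1 * q n * p' n + m 2 * q n * q' n : ℤ) : ℝ)| < 1 := by
      rw [e, abs_neg]
      refine (abs_add_le _ _).trans_lt ?_
      rw [abs_mul, abs_mul, abs_mul, abs_mul, Nat.abs_cast, Nat.abs_cast]
      refine lt_of_le_of_lt ?_ hn
      rw [add_mul]
      gcongr
    exact_mod_cast this
  have hbig : ∀ᶠ n in atTop, (|(m 0 : ℝ)| + |(m 1 : ℝ)|) < q n := h.tendsto_q.eventually_gt_atTop _
  obtain ⟨n, hn, hqn⟩ := (hint.and hbig).exists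
  have hq0 : (q n : ℤ) ≠ 0 := by have := h.pos n; omega
  have hq0' : (q' n : ℤ) ≠ 0 := by have := h.pos' n; omega
  have hq1 := h.one_le n
  have hm1 : m 1 = 0 := by
    have hd : (q' n : ℤ) ∣ (m 1 * q n) * p' n :=
      ⟨-(m 0 * p n + m 2 * q n), by linear_combination hn⟩
    have hd2 := (h.coprime' n).symm.dvd_of_dvd_mul_right hd
    by_contra hne
    have h1 := Int.le_of_dvd (abs_pos.2 (mul_ne_zero hne hq0)) ((dvd_abs _ _).2 hd2)
    have h2 : (q' n : ℝ) ≤ |(m 1 : ℝ)| * q n := by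
      rw [abs_mul, Nat.abs_cast] at h1
      exact_mod_cast h1
    have h3 := h.pow_le_of_le_four n (k := 2) (by norm_num)
    nlinarith [abs_nonneg (m 0 : ℝ)]
  have hn2 : m 0 * p n + m 2 * q n = 0 := by
    refine mul_left_cancel₀ hq0' ?_
    rw [hm1] at hn
    linear_combination hn
  have hm0 : m 0 = 0 := by
    have hd : (q n : ℤ) ∣ m 0 * p n := ⟨-(m 2), by linear_combination hn2⟩
    have hd2 := (h.coprime n).symm.dvd_of_dvd_mul_right hd
    by_contra hne
    have h1 := Int.le_of_dvd (abs_pos.2 hne) ((dvd_abs _ _).2 hd2)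
    have h2 : (q n : ℝ) ≤ |(m 0 : ℝ)| := by exact_mod_cast h1
    linarith [abs_nonneg (m 1 : ℝ)]
  have hm2 : m 2 = 0 := by
    rw [hm0, zero_mul, zero_add] at hn2
    exact (mul_eq_zero.1 hn2).resolve_right hq0
  ext j
  fin_cases j <;> assumption

/-- At times `s = O(e^{q'ₙ})` all resonances but the `n`-th one contribute `O(qₙ)`: the earlier ones
because `|qₖα - pₖ| ≥ 1 / (2qₙ)` makes them average out, the later ones because of their small
amplitudes. -/
theorem abs_hasSum_sub_le {n : ℕ} {s S : ℝ} (hs : 0 ≤ s) (hs' : s ≤ 3 * exp (q' n))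
    {b u κ : ℕ → ℝ} {M : ℝ} (hM : 0 ≤ M) (hκ : ∀ k, 1 ≤ κ k) (hb : HasSum b S)
    (hbound : ∀ k, |b k| ≤ M *
      ((q' k : ℝ) ^ 2 * exp (-(q' k : ℝ)) * |osc (u k) (κ k * (q k * α - p k)) s|)) :
    |S - b n| ≤ M * (q n * nonresonantBound q') := by
  have hq := h.one_le n
  have hterm : ∀ k, k ≠ n →
      |b k| ≤ M * (q n * (3 * ((q' k : ℝ) ^ 2 * exp (-(q' k : ℝ) / 2)))) := by
    intro k hk
    refine (hbound k).trans (mul_le_mul_of_nonneg_left ?_ hM)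
    rcases lt_or_gt_of_ne hk with hlt | hgt
    · have hd := h.half_le_mul_approx hlt
      have hne := h.approx_ne_zero k
      have hκ0 : κ k ≠ 0 := (zero_lt_one.trans_le (hκ k)).ne'
      have h1 : |osc (u k) (κ k * (q k * α - p k)) s| ≤ q n := by
        refine (abs_osc_le_inv (mul_ne_zero hκ0 hne) _ _).trans ?_
        rw [abs_mul, abs_of_pos (zero_lt_one.trans_le (hκ k)), div_le_iff₀ (by
          have := hκ k
          have := abs_pos.2 hne
          positivity)]
        have : 1 * (1 / 2) ≤ κ k * (q n * |q k * α - p k|) :=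
          mul_le_mul (hκ k) hd (by norm_num) (by linarith [hκ k])
        nlinarith [pi_gt_three]
      have h2 : exp (-(q' k : ℝ)) ≤ exp (-(q' k : ℝ) / 2) :=
        exp_le_exp.2 (by linarith [h.one_le' k])
      calc _ ≤ (q' k : ℝ) ^ 2 * exp (-(q' k : ℝ) / 2) * q n := by gcongr
        _ ≤ 3 * ((q' k : ℝ) ^ 2 * exp (-(q' k : ℝ) / 2) * q n) :=
            le_mul_of_one_le_left (by positivity) (by norm_num)
        _ = _ := by ring
    · have h1 : |osc (u k) (κ k * (q k * α - p k)) s| ≤ 3 * exp ((q' k : ℝ) / 2) := by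
        refine (abs_osc_le _ _ hs).trans (hs'.trans ?_)
        gcongr
        linarith [h.six_mul_le hgt, h.one_le' n]
      calc _ ≤ (q' k : ℝ) ^ 2 * exp (-(q' k : ℝ)) * (3 * exp ((q' k : ℝ) / 2)) := by gcongr
        _ = 1 * (3 * ((q' k : ℝ) ^ 2 * exp (-(q' k : ℝ) / 2))) := by
            rw [show -(q' k : ℝ) / 2 = -(q' k : ℝ) + (q' k : ℝ) / 2 by ring, exp_add]
            ring
        _ ≤ _ := by gcongr
  have hD := (((h.summable_weight 2).mul_left 3).mul_left (q n : ℝ)).mul_left M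
  have h0 := hb.update n 0
  rw [zero_sub, add_comm, ← sub_eq_add_neg] at h0
  rw [← h0.tsum_eq, nonresonantBound, ← tsum_mul_left, ← tsum_mul_left, ← norm_eq_abs]
  refine tsum_of_norm_bounded hD.hasSum fun k => ?_
  by_cases hk : k = n
  · subst hk
    simp only [Function.update_self, norm_zero]
    positivity
  · rw [Function.update_of_ne hk, norm_eq_abs]
    exact hterm k hk

end LiouvillePair

/-! ### Periodicity in the angles -/

theorem toTorus_eq_iff {θ θ' : Fin 3 → ℝ} :
    toTorus θ' = toTorus θ ↔ ∃ k : Fin 3 → ℤ, θ' = fun j => θ j + k j := by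
  constructor
  · intro h
    have h1 : ∀ j, ∃ k : ℤ, θ' j = θ j + k := fun j => by
      have h2 : ((θ' j - θ j : ℝ) : UnitAddCircle) = 0 := by
        rw [AddCircle.coe_sub, sub_eq_zero]
        exact congrFun h j
      obtain ⟨k, hk⟩ := (AddCircle.coe_eq_zero_iff 1).1 h2
      refine ⟨k, ?_⟩
      rw [zsmul_eq_mul, mul_one] at hk
      linarith
    choose k hk using h1
    exact ⟨k, funext hk⟩
  · rintro ⟨k, rfl⟩
    ext j
    change ((θ j + k j : ℝ) : UnitAddCircle) = (θ j : UnitAddCircle)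
    have hk : ((k j : ℝ) : UnitAddCircle) = 0 := (AddCircle.coe_eq_zero_iff 1).2 ⟨k j, by simp⟩
    rw [AddCircle.coe_add, hk, add_zero]

theorem toTorus_surjective : Function.Surjective toTorus := fun z => by
  choose θ hθ using fun j => QuotientAddGroup.mk_surjective (z j)
  exact ⟨θ, funext hθ⟩

theorem trigSeries_add_int {a : ℕ → ℝ} {m : ℕ → Fin 3 → ℝ} (hm : ∀ n j, ∃ i : ℤ, m n j = i)
    (β : ℝ) (θ : Fin 3 → ℝ) (k : Fin 3 → ℤ) :
    trigSeries a m β (fun j => θ j + k j) = trigSeries a m β θ := by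
  refine tsum_congr fun n => ?_
  choose i hi using hm n
  refine congrArg _ (cos_int_shift _ _ (∑ j, i j * k j) ?_)
  simp only [dotProduct, Fin.sum_univ_three, hi]
  push_cast
  ring

/-! ### The three series -/

/-- The amplitudes of the series `φ - 1`. -/
noncomputable def phiAmp (q q' : ℕ → ℕ) (n : ℕ) : ℝ := q n * exp (-(q' n : ℝ))

/-- The frequencies of the series `φ - 1`. -/
def phiFreq (p : ℕ → ℤ) (q : ℕ → ℕ) (n : ℕ) : Fin 3 → ℝ := ![q n, 0, -p n]

/-- The amplitudes of the resonant part of `h̃` in `(θ₁, θ₃)`. -/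
noncomputable def hAmp (q q' : ℕ → ℕ) (n : ℕ) : ℝ := (q n : ℝ) ^ 2 * exp (-(q' n : ℝ))

/-- The frequencies of the resonant part of `h̃` in `(θ₁, θ₃)`. -/
def hFreq (p : ℕ → ℤ) (q : ℕ → ℕ) (n : ℕ) : Fin 3 → ℝ :=
  ![(q n : ℝ) ^ 3, 0, -((q n : ℝ) ^ 2 * p n)]

/-- The amplitudes of the resonant part of `h̃` in `(θ₂, θ₃)`. -/
noncomputable def hAmp' (q' : ℕ → ℕ) (n : ℕ) : ℝ := exp (-(q' n : ℝ))

/-- The frequencies of the resonant part of `h̃` in `(θ₂, θ₃)`. -/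
def hFreq' (p' : ℕ → ℤ) (q' : ℕ → ℕ) (n : ℕ) : Fin 3 → ℝ := ![0, q' n, -p' n]

/-- The function `cφ - h̃`; the energy surface `{H̃ = c}` is given by `⟨r, ω⟩ = cφ(θ) - h̃(θ)`. -/
noncomputable def levelFn (p p' : ℕ → ℤ) (q q' : ℕ → ℕ) (c : ℝ) (θ : Fin 3 → ℝ) : ℝ :=
  c * phi p q q' θ - tildeh p p' q q' θ

/-- The partial derivative `∂_{θⱼ}(cφ - h̃)`, as a sum of trigonometric series.  The phase `1 / 4`
turns the derivative `-sin` of `cos` back into a cosine. -/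
noncomputable def levelForce (p p' : ℕ → ℤ) (q q' : ℕ → ℕ) (c : ℝ) (j : Fin 3)
    (θ : Fin 3 → ℝ) : ℝ :=
  c * trigSeries (fun n => 2 * π * phiAmp q q' n * phiFreq p q n j) (phiFreq p q) (0 + 1 / 4) θ +
    trigSeries (fun n => 2 * π * hAmp q q' n * hFreq p q n j) (hFreq p q) (0 + 1 / 4) θ +
    trigSeries (fun n => 2 * π * hAmp' q' n * hFreq' p' q' n j) (hFreq' p' q') (0 + 1 / 4) θ

section Series

variable (p p' : ℕ → ℤ) (q q' : ℕ → ℕ)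

theorem phiTerm_eq (n : ℕ) (θ : Fin 3 → ℝ) :
    phiTerm p q q' n θ = phiAmp q q' n * cos (2 * π * (phiFreq p q n ⬝ᵥ θ + 0)) := by
  simp only [phiTerm, phiAmp, phiFreq, dotProduct, Fin.sum_univ_three, Matrix.cons_val]
  ring_nf

theorem hTerm_eq (n : ℕ) (θ : Fin 3 → ℝ) :
    hTerm p q q' n θ = hAmp q q' n * cos (2 * π * (hFreq p q n ⬝ᵥ θ + 0)) := by
  simp only [hTerm, hAmp, hFreq, dotProduct, Fin.sum_univ_three, Matrix.cons_val]
  ring_nf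

theorem hTerm'_eq (n : ℕ) (θ : Fin 3 → ℝ) :
    hTerm' p' q' n θ = hAmp' q' n * cos (2 * π * (hFreq' p' q' n ⬝ᵥ θ + 0)) := by
  simp only [hTerm', hAmp', hFreq', dotProduct, Fin.sum_univ_three, Matrix.cons_val]
  ring_nf

theorem phi_eq : phi p q q' = fun θ => 1 + trigSeries (phiAmp q q') (phiFreq p q) 0 θ := by
  ext θ
  simp only [phi, phiTerm_eq, trigSeries]

theorem tildeh_eq : tildeh p p' q q' = fun θ =>
    -trigSeries (hAmp q q') (hFreq p q) 0 θ - trigSeries (hAmp' q') (hFreq' p' q') 0 θ := by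
  ext θ
  simp only [tildeh, hTerm_eq, hTerm'_eq, trigSeries]

theorem phiFreq_int (n : ℕ) (j : Fin 3) : ∃ i : ℤ, phiFreq p q n j = i := by
  refine ⟨(![(q n : ℤ), 0, -p n] : Fin 3 → ℤ) j, ?_⟩
  fin_cases j <;> simp [phiFreq]

theorem hFreq_int (n : ℕ) (j : Fin 3) : ∃ i : ℤ, hFreq p q n j = i := by
  refine ⟨(![(q n : ℤ) ^ 3, 0, -((q n : ℤ) ^ 2 * p n)] : Fin 3 → ℤ) j, ?_⟩
  fin_cases j <;> simp [hFreq]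

theorem hFreq'_int (n : ℕ) (j : Fin 3) : ∃ i : ℤ, hFreq' p' q' n j = i := by
  refine ⟨(![0, (q' n : ℤ), -p' n] : Fin 3 → ℤ) j, ?_⟩
  fin_cases j <;> simp [hFreq']

variable (θ : Fin 3 → ℝ) (k : Fin 3 → ℤ)

theorem phi_add_int : phi p q q' (fun j => θ j + k j) = phi p q q' θ := by
  simp only [phi_eq, trigSeries_add_int (phiFreq_int p q)]

theorem tildeh_add_int : tildeh p p' q q' (fun j => θ j + k j) = tildeh p p' q q' θ := by
  simp only [tildeh_eq, trigSeries_add_int (hFreq_int p q), trigSeries_add_int (hFreq'_int p' q')]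

theorem levelFn_add_int (c : ℝ) :
    levelFn p p' q q' c (fun j => θ j + k j) = levelFn p p' q q' c θ := by
  simp only [levelFn, phi_add_int, tildeh_add_int]

theorem levelForce_add_int (c : ℝ) (j : Fin 3) :
    levelForce p p' q q' c j (fun j => θ j + k j) = levelForce p p' q q' c j θ := by
  simp only [levelForce, trigSeries_add_int (hFreq_int p q),
    trigSeries_add_int (hFreq'_int p' q'), trigSeries_add_int (phiFreq_int p q)]

end Series

/-! ### The Hamiltonian and its flow -/

theorem continuous_line (θ v : Fin 3 → ℝ) : Continuous fun u : ℝ => θ + u • v := by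
  fun_prop

theorem eq_of_hasDerivAt_zero {f : ℝ → ℝ} (hf : ∀ t, HasDerivAt f 0 t) (t : ℝ) : f t = f 0 :=
  is_const_of_deriv_eq_zero (fun t => (hf t).differentiableAt) (fun t => (hf t).deriv) t 0

/-- The time the flow needs to follow the segment from `θ` to `θ + sω`: its speed is `1 / φ`. -/
noncomputable def travelTime (p : ℕ → ℤ) (q q' : ℕ → ℕ) (w θ : Fin 3 → ℝ) (s : ℝ) : ℝ :=
  ∫ u in (0 : ℝ)..s, phi p q q' (θ + u • w)

/-- The length `s` of the segment from `θ` to `θ + sω` that the flow covers in a given time: the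
inverse function of `travelTime`. -/
noncomputable def advance (p : ℕ → ℤ) (q q' : ℕ → ℕ) (w θ : Fin 3 → ℝ) : ℝ → ℝ :=
  Function.invFun (travelTime p q q' w θ)

/-- The explicit solution of Hamilton's equations through `(θ, r)`, as a function of the length `s`
covered by the angles. -/
noncomputable def orbit (α α' : ℝ) (p p' : ℕ → ℤ) (q q' : ℕ → ℕ) (θ r : Fin 3 → ℝ) (s : ℝ) :
    LiftedPhase :=
  (θ + s • freq α α', fun j => r j + ∫ u in (0 : ℝ)..s,
    levelForce p p' q q' (tildeH α α' p p' q q' (θ, r)) j (θ + u • freq α α'))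

namespace LiouvillePair

variable {α α' : ℝ} {p p' : ℕ → ℤ} {q q' : ℕ → ℕ} (h : LiouvillePair α α' p p' q q')
include h

/-- The numerators are comparable to the denominators. -/
theorem abs_p_le (n : ℕ) : |(p n : ℝ)| ≤ q n * (|α| + 1) := by
  have h1 := h.approx n
  have h2 : exp (-(2 * q' n : ℝ)) ≤ 1 := exp_le_one_iff.2 (by linarith [h.one_le' n])
  have h3 : (p n : ℝ) = q n * α - (q n * α - p n) := by ring
  have h4 := abs_sub (q n * α) (q n * α - p n)
  rw [← h3, abs_mul, Nat.abs_cast] at h4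
  linarith [h.one_le n]

theorem abs_p_le' (n : ℕ) : |(p' n : ℝ)| ≤ q' n * (|α'| + 1) := by
  have h1 := h.approx' n
  have h2 : exp (-(q' n : ℝ)) ≤ 1 := exp_le_one_iff.2 (by linarith [h.one_le' n])
  have h3 : (p' n : ℝ) = q' n * α' - (q' n * α' - p' n) := by ring
  have h4 := abs_sub (q' n * α') (q' n * α' - p' n)
  rw [← h3, abs_mul, Nat.abs_cast] at h4
  linarith [h.one_le' n]

/-- It suffices that the frequencies are `O(q'ₙ)`, as `e^{-q'ₙ}` beats all powers of `q'ₙ`. -/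
theorem rapidDecay_of_le {a : ℕ → ℝ} {m : ℕ → Fin 3 → ℝ} {C : ℝ}
    (ha : ∀ n, |a n| ≤ q' n * exp (-(q' n : ℝ))) (hm : ∀ n, 1 + ∑ j, |m n j| ≤ C * q' n) :
    RapidDecay a m := by
  intro N
  refine Summable.of_nonneg_of_le (fun n => by positivity) (fun n => ?_)
    ((h.summable_weight (N + 1)).mul_left (C ^ N))
  have h1 : exp (-(q' n : ℝ)) ≤ exp (-(q' n : ℝ) / 2) :=
    exp_le_exp.2 (by linarith [h.one_le' n])
  calc _ ≤ q' n * exp (-(q' n : ℝ) / 2) * (C * q' n) ^ N := by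
        gcongr
        · exact (ha n).trans (by gcongr)
        · exact hm n
    _ = _ := by ring

theorem rapidDecay_phi : RapidDecay (phiAmp q q') (phiFreq p q) := by
  refine h.rapidDecay_of_le (C := |α| + 3) (fun n => ?_) fun n => ?_
  · rw [phiAmp, abs_of_nonneg (by positivity)]
    gcongr
    exact_mod_cast h.le' n
  · simp only [phiFreq, Fin.sum_univ_three, Matrix.cons_val, Nat.abs_cast, abs_zero, abs_neg]
    have := h.abs_p_le n
    have := h.le' n
    have := h.one_le n
    nlinarith [abs_nonneg α]

theorem rapidDecay_h : RapidDecay (hAmp q q') (hFreq p q) := by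
  refine h.rapidDecay_of_le (C := |α| + 3) (fun n => ?_) fun n => ?_
  · rw [hAmp, abs_of_nonneg (by positivity)]
    gcongr
    exact h.pow_le_of_le_four n (by norm_num)
  · simp only [hFreq, Fin.sum_univ_three, Matrix.cons_val, abs_zero, abs_neg, abs_mul, abs_pow,
      Nat.abs_cast]
    have h1 := h.abs_p_le n
    have h3 := h.pow_le_of_le_four n (k := 3) (by norm_num)
    have h4 := h.one_le' n
    have h5 : (q n : ℝ) ^ 2 * |(p n : ℝ)| ≤ (q n : ℝ) ^ 3 * (|α| + 1) := by
      calc _ ≤ (q n : ℝ) ^ 2 * (q n * (|α| + 1)) := by gcongr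
        _ = _ := by ring
    nlinarith [abs_nonneg α]

theorem rapidDecay_h' : RapidDecay (hAmp' q') (hFreq' p' q') := by
  refine h.rapidDecay_of_le (C := |α'| + 3) (fun n => ?_) fun n => ?_
  · rw [hAmp', abs_of_nonneg (by positivity)]
    exact le_mul_of_one_le_left (by positivity) (h.one_le' n)
  · simp only [hFreq', Fin.sum_univ_three, Matrix.cons_val, Nat.abs_cast, abs_zero, abs_neg]
    have := h.abs_p_le' n
    have := h.one_le' n
    nlinarith [abs_nonneg α']

theorem summable_phiTerm (θ : Fin 3 → ℝ) : Summable fun n => phiTerm p q q' n θ := by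
  simpa only [phiTerm_eq] using h.rapidDecay_phi.summable_term 0 θ

theorem summable_hTerm (θ : Fin 3 → ℝ) : Summable fun n => hTerm p q q' n θ := by
  simpa only [hTerm_eq] using h.rapidDecay_h.summable_term 0 θ

theorem summable_hTerm' (θ : Fin 3 → ℝ) : Summable fun n => hTerm' p' q' n θ := by
  simpa only [hTerm'_eq] using h.rapidDecay_h'.summable_term 0 θ

/-- The geometric series `∑ e^{-(n+1)} = 1 / (e - 1) < 3 / 5` dominates `φ - 1`. -/
theorem abs_phi_sub_one_le (θ : Fin 3 → ℝ) : |phi p q q' θ - 1| ≤ 3 / 5 := by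
  have he : exp (-1) ≤ 3 / 8 := by
    rw [exp_neg, inv_le_comm₀ (exp_pos 1) (by norm_num)]
    exact le_trans (by norm_num) exp_one_gt_d9.le
  have hgeom := (hasSum_geometric_of_lt_one (exp_pos (-1)).le
    (he.trans_lt (by norm_num))).mul_left (exp (-1))
  have hb : ‖∑' n, phiTerm p q q' n θ‖ ≤ exp (-1) * (1 - exp (-1))⁻¹ := by
    refine tsum_of_norm_bounded hgeom fun n => ?_
    rw [phiTerm, norm_mul, norm_eq_abs, norm_eq_abs, abs_of_nonneg (by positivity)]
    have hq := h.one_le n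
    have h1 : (q n : ℝ) * exp (-(q' n : ℝ)) ≤ exp (-(q n : ℝ)) := by
      have h2 : (q n : ℝ) ≤ exp ((q' n : ℝ) - q n) := by
        have h3 := add_one_le_exp ((q' n : ℝ) - q n)
        have h4 := h.pow_four_le n
        nlinarith [sq_nonneg ((q n : ℝ) ^ 2 - 1), sq_nonneg ((q n : ℝ) - 1)]
      calc _ ≤ exp ((q' n : ℝ) - q n) * exp (-(q' n : ℝ)) := by gcongr
        _ = _ := by rw [← exp_add]; ring_nf
    calc _ ≤ exp (-(q n : ℝ)) * 1 := by
          gcongr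
          exact abs_cos_le_one _
      _ ≤ exp (-((n : ℝ) + 1)) := by rw [mul_one]; gcongr; exact h.add_one_le n
      _ = _ := by rw [← exp_nat_mul, ← exp_add]; ring_nf
  have h2 : exp (-1) * (1 - exp (-1))⁻¹ ≤ 3 / 5 := by
    rw [← div_eq_mul_inv, div_le_iff₀ (by linarith)]
    linarith
  rw [phi, add_sub_cancel_left]
  exact hb.trans h2

theorem le_phi (θ : Fin 3 → ℝ) : 2 / 5 ≤ phi p q q' θ := by
  linarith [(abs_le.1 (h.abs_phi_sub_one_le θ)).1]

theorem phi_le (θ : Fin 3 → ℝ) : phi p q q' θ ≤ 8 / 5 := by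
  linarith [(abs_le.1 (h.abs_phi_sub_one_le θ)).2]

theorem phi_pos (θ : Fin 3 → ℝ) : 0 < phi p q q' θ :=
  lt_of_lt_of_le (by norm_num) (h.le_phi θ)

theorem contDiff_phi : ContDiff ℝ ∞ (phi p q q') := by
  rw [phi_eq]
  exact contDiff_const.add (contDiff_trigSeries h.rapidDecay_phi 0)

theorem contDiff_tildeh : ContDiff ℝ ∞ (tildeh p p' q q') := by
  rw [tildeh_eq]
  exact (contDiff_trigSeries h.rapidDecay_h 0).neg.sub (contDiff_trigSeries h.rapidDecay_h' 0)

theorem contDiff_tildeH : ContDiff ℝ ∞ (tildeH α α' p p' q q') := by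
  unfold tildeH
  have hr : ∀ j : Fin 3, ContDiff ℝ ∞ fun z : LiftedPhase => z.2 j := fun j =>
    (contDiff_apply ℝ ℝ j).comp contDiff_snd
  exact ((ContDiff.sum fun j _ => (hr j).mul contDiff_const).add
    (h.contDiff_tildeh.comp contDiff_fst)).div (h.contDiff_phi.comp contDiff_fst)
    fun z => (h.phi_pos _).ne'

theorem continuous_phi : Continuous (phi p q q') := h.contDiff_phi.continuous

theorem continuous_levelFn (c : ℝ) : Continuous (levelFn p p' q q' c) :=
  (continuous_const.mul h.continuous_phi).sub h.contDiff_tildeh.continuous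

theorem continuous_levelForce (c : ℝ) (j : Fin 3) : Continuous (levelForce p p' q q' c j) :=
  ((continuous_const.mul (continuous_trigSeries (h.rapidDecay_phi.partialDeriv j) _)).add
    (continuous_trigSeries (h.rapidDecay_h.partialDeriv j) _)).add
    (continuous_trigSeries (h.rapidDecay_h'.partialDeriv j) _)

theorem hasFDerivAt_levelFn (c : ℝ) (θ : Fin 3 → ℝ) :
    HasFDerivAt (levelFn p p' q q' c) (∑ j, levelForce p p' q q' c j θ •
      ContinuousLinearMap.proj (R := ℝ) (φ := fun _ : Fin 3 => ℝ) j) θ := by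
  have h1 := ((hasFDerivAt_trigSeries h.rapidDecay_phi 0 θ).const_add 1).const_mul c
  have h2 := (hasFDerivAt_trigSeries h.rapidDecay_h 0 θ).neg
  have h3 := hasFDerivAt_trigSeries h.rapidDecay_h' 0 θ
  have h4 := h1.sub (h2.sub h3)
  have e : levelFn p p' q q' c = fun θ => c * (1 + trigSeries (phiAmp q q') (phiFreq p q) 0 θ) -
      (-trigSeries (hAmp q q') (hFreq p q) 0 θ - trigSeries (hAmp' q') (hFreq' p' q') 0 θ) := by
    ext θ
    simp only [levelFn, phi_eq, tildeh_eq]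
  rw [e]
  refine h4.congr_fderiv ?_
  ext v
  simp only [levelForce, Fin.sum_univ_three, add_apply,
    sub_apply, neg_apply, smul_apply,
    smul_eq_mul]
  ring

theorem hasDerivAt_levelFn_line (c : ℝ) (θ v : Fin 3 → ℝ) (s : ℝ) :
    HasDerivAt (fun s : ℝ => levelFn p p' q q' c (θ + s • v))
      (∑ j, levelForce p p' q q' c j (θ + s • v) * v j) s := by
  have h1 : HasDerivAt (fun s : ℝ => θ + s • v) v s := by
    simpa using ((hasDerivAt_id s).smul_const v).const_add θ
  refine ((h.hasFDerivAt_levelFn c _).comp_hasDerivAt s h1).congr_deriv ?_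
  simp

theorem tildeH_eq_iff (c : ℝ) (θ r : Fin 3 → ℝ) :
    tildeH α α' p p' q q' (θ, r) = c ↔ ∑ j, r j * freq α α' j = levelFn p p' q q' c θ := by
  rw [tildeH, div_eq_iff (h.phi_pos _).ne', levelFn, eq_sub_iff_add_eq]

theorem fderiv_tildeH_action (z : LiftedPhase) (j : Fin 3) :
    fderiv ℝ (tildeH α α' p p' q q') z (0, Pi.single j 1) = freq α α' j / phi p q q' z.1 := by
  have hd : DifferentiableAt ℝ (tildeH α α' p p' q q') z :=
    h.contDiff_tildeH.differentiable (by simp) z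
  rw [← hd.lineDeriv_eq_fderiv]
  have e : (fun s : ℝ => tildeH α α' p p' q q' (z + s • ((0 : Fin 3 → ℝ), Pi.single j 1))) =
      fun s => tildeH α α' p p' q q' z + s * (freq α α' j / phi p q q' z.1) := by
    ext s
    simp only [tildeH, Prod.fst_add, Prod.smul_fst, smul_zero, add_zero, Prod.snd_add,
      Prod.smul_snd, Pi.add_apply, Pi.smul_apply, smul_eq_mul, add_mul, Finset.sum_add_distrib,
      mul_assoc, Pi.single_apply, ite_mul, one_mul, zero_mul, mul_ite, mul_zero,
      Finset.sum_ite_eq', Finset.mem_univ, if_true]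
    ring
  rw [lineDeriv, e]
  simp

/-- On an energy surface, the force is that of the function `cφ - h̃`, up to the factor `1 / φ`. -/
theorem fderiv_tildeH_angle (z : LiftedPhase) (j : Fin 3) :
    -fderiv ℝ (tildeH α α' p p' q q') z (Pi.single j 1, 0) =
      levelForce p p' q q' (tildeH α α' p p' q q' z) j z.1 / phi p q q' z.1 := by
  have hd : DifferentiableAt ℝ (tildeH α α' p p' q q') z :=
    h.contDiff_tildeH.differentiable (by simp) z
  set c := tildeH α α' p p' q q' z with hc
  -- Along the line, `(H̃ - c) φ = ⟨r, ω⟩ - (cφ - h̃)`, and the first factor vanishes at `z`.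
  rw [← hd.lineDeriv_eq_fderiv]
  set v : Fin 3 → ℝ := Pi.single j 1 with hv
  set N := ∑ i, z.2 i * freq α α' i with hN
  have e : (fun s : ℝ => tildeH α α' p p' q q' (z + s • (v, (0 : Fin 3 → ℝ)))) =
      fun s => c + (N - levelFn p p' q q' c (z.1 + s • v)) / phi p q q' (z.1 + s • v) := by
    ext s
    have hphi := (h.phi_pos (z.1 + s • v)).ne'
    simp only [tildeH, levelFn, Prod.fst_add, Prod.smul_fst, Prod.snd_add, Prod.smul_snd,
      smul_zero, add_zero, ← hN]
    field_simp
    ring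
  have h0 : N - levelFn p p' q q' c z.1 = 0 := by
    rw [hN, (h.tildeH_eq_iff c z.1 z.2).1 rfl, sub_self]
  have h1 := h.hasDerivAt_levelFn_line c z.1 v 0
  have h2 : DifferentiableAt ℝ (fun s : ℝ => phi p q q' (z.1 + s • v)) 0 := by
    refine (h.contDiff_phi.differentiable (by simp)).differentiableAt.comp _ ?_
    fun_prop
  have h3 := ((h1.const_sub N).div h2.hasDerivAt (h.phi_pos _).ne').const_add c
  rw [lineDeriv, e]
  refine (congrArg Neg.neg h3.deriv).trans ?_
  simp only [zero_smul, add_zero, h0, zero_mul, sub_zero, hv, Pi.single_apply, mul_ite, mul_one,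
    mul_zero, Finset.sum_ite_eq', Finset.mem_univ, if_true]
  have hphi := (h.phi_pos z.1).ne'
  field_simp

theorem hasDerivAt_travelTime (w θ : Fin 3 → ℝ) (s : ℝ) :
    HasDerivAt (travelTime p q q' w θ) (phi p q q' (θ + s • w)) s :=
  ((h.continuous_phi.comp (continuous_line θ w)).integral_hasStrictDerivAt 0 s).hasDerivAt

theorem travelTime_sub_mem (w θ : Fin 3 → ℝ) {s s' : ℝ} (hs : s ≤ s') :
    2 / 5 * (s' - s) ≤ travelTime p q q' w θ s' - travelTime p q q' w θ s ∧
    travelTime p q q' w θ s' - travelTime p q q' w θ s ≤ 8 / 5 * (s' - s) := by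
  have hc := h.continuous_phi.comp (continuous_line θ w)
  have e : travelTime p q q' w θ s' - travelTime p q q' w θ s =
      ∫ u in s..s', phi p q q' (θ + u • w) :=
    intervalIntegral.integral_interval_sub_left (hc.intervalIntegrable _ _)
      (hc.intervalIntegrable _ _)
  rw [e]
  constructor
  · have := intervalIntegral.integral_mono_on (μ := MeasureTheory.volume) hs
      (f := fun _ => (2 / 5 : ℝ)) intervalIntegrable_const (hc.intervalIntegrable s s')
      fun u _ => h.le_phi _
    rw [intervalIntegral.integral_const, smul_eq_mul, mul_comm] at this
    exact this
  · have := intervalIntegral.integral_mono_on (μ := MeasureTheory.volume) hs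
      (g := fun _ => (8 / 5 : ℝ))
      (hc.intervalIntegrable s s') intervalIntegrable_const fun u _ => h.phi_le _
    rw [intervalIntegral.integral_const, smul_eq_mul, mul_comm] at this
    exact this

theorem abs_sub_le_travelTime (w θ : Fin 3 → ℝ) (s s' : ℝ) :
    2 / 5 * |s' - s| ≤ |travelTime p q q' w θ s' - travelTime p q q' w θ s| := by
  rcases le_total s s' with hs | hs
  · have := h.travelTime_sub_mem w θ hs
    rw [abs_of_nonneg (sub_nonneg.2 hs)]
    exact this.1.trans (le_abs_self _)
  · have := h.travelTime_sub_mem w θ hs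
    rw [abs_sub_comm, abs_sub_comm (travelTime p q q' w θ s'), abs_of_nonneg (sub_nonneg.2 hs)]
    exact this.1.trans (le_abs_self _)

theorem travelTime_injective (w θ : Fin 3 → ℝ) :
    Function.Injective (travelTime p q q' w θ) := fun s s' hs => by
  have := h.abs_sub_le_travelTime w θ s' s
  rw [hs, sub_self, abs_zero] at this
  have h1 : |s - s'| = 0 := le_antisymm (by linarith) (abs_nonneg _)
  linarith [abs_eq_zero.1 h1]

omit h in
theorem travelTime_zero (w θ : Fin 3 → ℝ) : travelTime p q q' w θ 0 = 0 := by
  simp [travelTime]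

theorem travelTime_surjective (w θ : Fin 3 → ℝ) :
    Function.Surjective (travelTime p q q' w θ) := by
  have hc : Continuous (travelTime p q q' w θ) :=
    continuous_iff_continuousAt.2 fun s => (h.hasDerivAt_travelTime w θ s).continuousAt
  have h0 := travelTime_zero (p := p) (q := q) (q' := q') w θ
  refine hc.surjective ?_ ?_
  · refine tendsto_atTop_mono' atTop ?_ (tendsto_id.const_mul_atTop (by norm_num : (0 : ℝ) < 2 / 5))
    filter_upwards [eventually_ge_atTop 0] with s hs
    have := (h.travelTime_sub_mem w θ hs).1
    rw [h0] at this
    simp only [id]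
    linarith
  · refine tendsto_atBot_mono' atBot ?_ (tendsto_id.const_mul_atBot (by norm_num : (0 : ℝ) < 2 / 5))
    filter_upwards [eventually_le_atBot 0] with s hs
    have := (h.travelTime_sub_mem w θ hs).1
    rw [h0] at this
    simp only [id]
    linarith

theorem travelTime_advance (w θ : Fin 3 → ℝ) (t : ℝ) :
    travelTime p q q' w θ (advance p q q' w θ t) = t :=
  Function.rightInverse_invFun (h.travelTime_surjective w θ) t

theorem advance_travelTime (w θ : Fin 3 → ℝ) (s : ℝ) :
    advance p q q' w θ (travelTime p q q' w θ s) = s :=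
  Function.leftInverse_invFun (h.travelTime_injective w θ) s

theorem hasDerivAt_advance (w θ : Fin 3 → ℝ) (t : ℝ) :
    HasDerivAt (advance p q q' w θ)
      (phi p q q' (θ + advance p q q' w θ t • w))⁻¹ t := by
  refine HasDerivAt.of_local_left_inverse ?_ (h.hasDerivAt_travelTime w θ _) (h.phi_pos _).ne'
    (Eventually.of_forall fun t => h.travelTime_advance w θ t)
  have hL : LipschitzWith (5 / 2) (advance p q q' w θ) := by
    refine LipschitzWith.of_dist_le_mul fun t t' => ?_
    have := h.abs_sub_le_travelTime w θ (advance p q q' w θ t') (advance p q q' w θ t)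
    rw [h.travelTime_advance, h.travelTime_advance] at this
    rw [dist_eq, dist_eq]
    push_cast
    linarith
  exact hL.continuous.continuousAt

theorem hasDerivAt_integral_levelForce (c : ℝ) (j : Fin 3) (w θ : Fin 3 → ℝ) (s : ℝ) :
    HasDerivAt (fun s => ∫ u in (0 : ℝ)..s, levelForce p p' q q' c j (θ + u • w))
      (levelForce p p' q q' c j (θ + s • w)) s :=
  (((h.continuous_levelForce c j).comp (continuous_line θ w)).integral_hasStrictDerivAt
    0 s).hasDerivAt

theorem tildeH_orbit (θ r : Fin 3 → ℝ) (s : ℝ) :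
    tildeH α α' p p' q q' (orbit α α' p p' q q' θ r s) = tildeH α α' p p' q q' (θ, r) := by
  set c := tildeH α α' p p' q q' (θ, r) with hc
  rw [orbit, h.tildeH_eq_iff, ← hc]
  have h0 := (h.tildeH_eq_iff c θ r).1 hc.symm
  have hd : ∀ s, HasDerivAt (fun s => ∑ j, (r j + ∫ u in (0 : ℝ)..s,
      levelForce p p' q q' c j (θ + u • freq α α')) * freq α α' j -
      levelFn p p' q q' c (θ + s • freq α α')) 0 s := fun s => by
    have h1 := (HasDerivAt.fun_sum fun j (_ : j ∈ Finset.univ) =>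
      ((h.hasDerivAt_integral_levelForce c j (freq α α') θ s).const_add (r j)).mul_const
        (freq α α' j)).sub (h.hasDerivAt_levelFn_line c θ (freq α α') s)
    rwa [sub_self] at h1
  have h2 := eq_of_hasDerivAt_zero hd s
  simp only [intervalIntegral.integral_same, add_zero, zero_smul, h0, sub_self] at h2
  linarith

theorem solvesHamilton_orbit (θ r : Fin 3 → ℝ) :
    SolvesHamilton (tildeH α α' p p' q q') fun t =>
      orbit α α' p p' q q' θ r (advance p q q' (freq α α') θ t) := by
  intro t j
  rw [h.fderiv_tildeH_action, h.fderiv_tildeH_angle, h.tildeH_orbit]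
  have hs := h.hasDerivAt_advance (freq α α') θ t
  constructor
  · have h1 := (hs.mul_const (freq α α' j)).const_add (θ j)
    rw [div_eq_inv_mul]
    exact h1
  · have h1 := ((h.hasDerivAt_integral_levelForce (tildeH α α' p p' q q' (θ, r)) j (freq α α') θ
      (advance p q q' (freq α α') θ t)).comp t hs).const_add (r j)
    exact h1

/-- The explicit solutions are compatible with the translations by `ℤ³`, and descend to a flow. -/
theorem exists_isHamiltonianFlow : ∃ Φ, IsHamiltonianFlow (tildeH α α' p p' q q') Φ := by
  choose lift hlift using toTorus_surjective
  refine ⟨fun t z => (toTorus (orbit α α' p p' q q' (lift z.1) z.2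
    (advance p q q' (freq α α') (lift z.1) t)).1, (orbit α α' p p' q q' (lift z.1) z.2
    (advance p q q' (freq α α') (lift z.1) t)).2), fun θ r => ⟨_, ?_,
      h.solvesHamilton_orbit θ r, fun t => ?_⟩⟩
  · have h1 := h.advance_travelTime (freq α α') θ 0
    rw [travelTime_zero] at h1
    simp [h1, orbit]
  · obtain ⟨k, hk⟩ := toTorus_eq_iff.1 (hlift (toTorus θ))
    have hadd : ∀ v : Fin 3 → ℝ, lift (toTorus θ) + v = fun j => (θ + v) j + k j := fun v => by
      rw [hk]
      ext j
      simp only [Pi.add_apply]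
      ring
    have hadv : advance p q q' (freq α α') (lift (toTorus θ)) = advance p q q' (freq α α') θ := by
      have : travelTime p q q' (freq α α') (lift (toTorus θ)) =
          travelTime p q q' (freq α α') θ := by
        ext s
        simp only [travelTime, hadd, phi_add_int]
      rw [advance, this, advance]
    have hE : tildeH α α' p p' q q' (lift (toTorus θ), r) = tildeH α α' p p' q q' (θ, r) := by
      rw [hk, tildeH_periodic]
    simp only [orbit, hadv, hE, hadd, levelForce_add_int]
    exact Prod.ext (toTorus_eq_iff.2 ⟨k, rfl⟩) rfl

/-- Conservation of energy. -/
theorem tildeH_eq_of_solvesHamilton {γ : ℝ → LiftedPhase}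
    (hγ : SolvesHamilton (tildeH α α' p p' q q') γ) (t : ℝ) :
    tildeH α α' p p' q q' (γ t) = tildeH α α' p p' q q' (γ 0) := by
  refine eq_of_hasDerivAt_zero (f := fun t => tildeH α α' p p' q q' (γ t)) (fun t => ?_) t
  set L := fderiv ℝ (tildeH α α' p p' q q') (γ t) with hL
  have h1 : HasDerivAt γ ((fun j => L (0, Pi.single j 1)), fun j => -L (Pi.single j 1, 0)) t :=
    (hasDerivAt_pi.2 fun j => (hγ t j).1).prodMk (hasDerivAt_pi.2 fun j => (hγ t j).2)
  have hd : HasFDerivAt (tildeH α α' p p' q q') L (γ t) :=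
    (h.contDiff_tildeH.differentiable (by simp) (γ t)).hasFDerivAt
  refine (hd.comp_hasDerivAt t h1).congr_deriv ?_
  have hsplit : ∀ v w : Fin 3 → ℝ,
      L (v, w) = ∑ j, v j * L (Pi.single j 1, 0) + ∑ j, w j * L (0, Pi.single j 1) := by
    intro v w
    have e1 : (v, w) = ∑ j, v j • ((Pi.single j 1 : Fin 3 → ℝ), (0 : Fin 3 → ℝ)) +
        ∑ j, w j • ((0 : Fin 3 → ℝ), (Pi.single j 1 : Fin 3 → ℝ)) := by
      ext i <;> fin_cases i <;> simp [Fin.sum_univ_three]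
    rw [e1, map_add, map_sum, map_sum]
    simp only [map_smul, smul_eq_mul]
  rw [hsplit, ← Finset.sum_add_distrib]
  exact Finset.sum_eq_zero fun j _ => by ring

/-- Every Hamiltonian flow is the explicit one: the angles move along the line in direction `ω`
with speed `1 / φ`, while the actions integrate the force along it. -/
theorem flow_travelTime {Φ : ℝ → Phase → Phase}
    (hΦ : IsHamiltonianFlow (tildeH α α' p p' q q') Φ) (θ r : Fin 3 → ℝ) (s : ℝ) :
    Φ (travelTime p q q' (freq α α') θ s) (toTorus θ, r) =
      (toTorus (orbit α α' p p' q q' θ r s).1, (orbit α α' p p' q q' θ r s).2) := by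
  obtain ⟨γ, hγ0, hγ, hΦγ⟩ := hΦ θ r
  rw [hΦγ]
  have hE : ∀ t, tildeH α α' p p' q q' (γ t) = tildeH α α' p p' q q' (θ, r) := fun t => by
    rw [h.tildeH_eq_of_solvesHamilton hγ, hγ0]
  set c := tildeH α α' p p' q q' (θ, r) with hc
  have h1 : ∀ t j, HasDerivAt (fun s => (γ s).1 j) (freq α α' j / phi p q q' (γ t).1) t :=
    fun t j => h.fderiv_tildeH_action (γ t) j ▸ (hγ t j).1
  have h2 : ∀ t j, HasDerivAt (fun s => (γ s).2 j)
      (levelForce p p' q q' c j (γ t).1 / phi p q q' (γ t).1) t :=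
    fun t j => hE t ▸ h.fderiv_tildeH_angle (γ t) j ▸ (hγ t j).2
  set σ : ℝ → ℝ := fun t => (γ t).1 2 - θ 2 with hσ
  have hσ' : ∀ t, HasDerivAt σ (phi p q q' (γ t).1)⁻¹ t := fun t => by
    refine ((h1 t 2).sub_const (θ 2)).congr_deriv ?_
    simp [freq]
  have hθ : ∀ t, (γ t).1 = θ + σ t • freq α α' := fun t => by
    ext j
    have hd : ∀ t, HasDerivAt (fun t => (γ t).1 j - σ t * freq α α' j) 0 t := fun t => by
      refine ((h1 t j).sub ((hσ' t).mul_const (freq α α' j))).congr_deriv ?_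
      rw [div_eq_inv_mul, sub_self]
    have := eq_of_hasDerivAt_zero hd t
    simp only [hσ, hγ0, sub_self, zero_mul, sub_zero] at this
    simp only [Pi.add_apply, Pi.smul_apply, smul_eq_mul, hσ]
    linarith
  have hσ0 : σ 0 = 0 := by simp [hσ, hγ0]
  have hT : ∀ t, travelTime p q q' (freq α α') θ (σ t) = t := fun t => by
    have hd : ∀ t, HasDerivAt (fun t => travelTime p q q' (freq α α') θ (σ t) - t) 0 t := by
      intro t
      refine (((h.hasDerivAt_travelTime (freq α α') θ (σ t)).comp t (hσ' t)).sub
        (hasDerivAt_id t)).congr_deriv ?_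
      rw [← hθ, mul_inv_cancel₀ (h.phi_pos _).ne', sub_self]
    have := eq_of_hasDerivAt_zero hd t
    rw [hσ0, travelTime_zero] at this
    linarith
  have hr : ∀ t, (γ t).2 = (orbit α α' p p' q q' θ r (σ t)).2 := fun t => by
    ext j
    have hd : ∀ t, HasDerivAt (fun t => (γ t).2 j - ∫ u in (0 : ℝ)..σ t,
        levelForce p p' q q' c j (θ + u • freq α α')) 0 t := fun t => by
      refine ((h2 t j).sub ((h.hasDerivAt_integral_levelForce c j (freq α α') θ (σ t)).comp t
        (hσ' t))).congr_deriv ?_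
      rw [← hθ, div_eq_mul_inv, sub_self]
    have := eq_of_hasDerivAt_zero hd t
    simp only [hσ0, intervalIntegral.integral_same, hγ0, sub_zero] at this
    simp only [orbit, ← hc]
    linarith
  have hσs := h.travelTime_injective (freq α α') θ (hT (travelTime p q q' (freq α α') θ s))
  rw [hr, hθ, hσs]
  rfl

end LiouvillePair

/-! ### Minimality of nonresonant linear flows -/

section Kronecker

open MeasureTheory UnitAddTorus

variable {d : Type*}

/-- The linear flow on the torus with frequency vector `w`, started at the origin. -/
def linearFlow (w : d → ℝ) (s : ℝ) : UnitAddTorus d := fun j => ((s * w j : ℝ) : UnitAddCircle)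

theorem continuous_linearFlow (w : d → ℝ) : Continuous (linearFlow w) :=
  continuous_pi fun _ => (AddCircle.continuous_mk' 1).comp (by fun_prop)

theorem linearFlow_add (w : d → ℝ) (s t : ℝ) :
    linearFlow w (s + t) = linearFlow w s + linearFlow w t := by
  ext j
  simp only [linearFlow, add_mul, AddCircle.coe_add, Pi.add_apply]

variable [Fintype d]

theorem mFourier_linearFlow (n : d → ℤ) (w : d → ℝ) (s : ℝ) :
    mFourier n (linearFlow w s) = Complex.exp (2 * π * Complex.I * (∑ j, n j * w j : ℝ) * s) := by
  simp only [mFourier, ContinuousMap.coe_mk, linearFlow, fourier_coe_apply, ← Complex.exp_sum]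
  congr 1
  push_cast
  rw [Finset.mul_sum, Finset.sum_mul]
  exact Finset.sum_congr rfl fun j _ => by ring

theorem mFourier_add_apply (n : d → ℤ) (x y : UnitAddTorus d) :
    mFourier n (x + y) = mFourier n x * mFourier n y := by
  simp only [mFourier, ContinuousMap.coe_mk, fourier_apply, Pi.add_apply, zsmul_add,
    AddCircle.toCircle_add, Circle.coe_mul, Finset.prod_mul_distrib]

theorem integral_mFourier_eq_zero {μ : Measure (UnitAddTorus d)} [μ.IsAddLeftInvariant]
    {n : d → ℤ} {w : d → ℝ} (hw : ∑ j, (n j : ℝ) * w j ≠ 0) : ∫ x, mFourier n x ∂μ = 0 := by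
  set r := ∑ j, (n j : ℝ) * w j with hr
  -- Half a period of the character along the flow gives a translation that changes its sign.
  have hneg : mFourier n (linearFlow w (1 / (2 * r))) = -1 := by
    rw [mFourier_linearFlow, ← hr, ← Complex.exp_pi_mul_I]
    congr 1
    have : (r : ℂ) ≠ 0 := by exact_mod_cast hw
    push_cast
    field_simp
  have h1 := integral_add_left_eq_self (μ := μ) (fun x => mFourier n x)
    (linearFlow w (1 / (2 * r)))
  simp only [mFourier_add_apply, hneg, neg_one_mul, integral_neg] at h1
  exact self_eq_neg.1 h1.symm

theorem tendsto_average_mFourier {n : d → ℤ} {w : d → ℝ} (hw : ∑ j, (n j : ℝ) * w j ≠ 0) :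
    Tendsto (fun T : ℝ => (T : ℂ)⁻¹ * ∫ s in (0 : ℝ)..T, mFourier n (linearFlow w s))
      atTop (𝓝 0) := by
  set r := ∑ j, (n j : ℝ) * w j with hr
  set c : ℂ := 2 * π * Complex.I * r with hc
  have hc0 : c ≠ 0 := by
    have : (r : ℂ) ≠ 0 := by exact_mod_cast hw
    simp [hc, this, pi_ne_zero]
  have hbound : ∀ T : ℝ, 0 < T →
      ‖(T : ℂ)⁻¹ * ∫ s in (0 : ℝ)..T, mFourier n (linearFlow w s)‖ ≤ 2 / ‖c‖ * T⁻¹ := by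
    intro T hT
    have hunit : ∀ s : ℝ, ‖Complex.exp (c * s)‖ = 1 := fun s => by
      rw [Complex.norm_exp]
      simp [hc]
    simp only [mFourier_linearFlow, ← hr, ← hc]
    rw [integral_exp_mul_complex hc0, norm_mul, norm_inv, Complex.norm_real, norm_eq_abs,
      abs_of_pos hT, norm_div, mul_comm]
    gcongr
    refine (norm_sub_le _ _).trans ?_
    rw [hunit, hunit]
    norm_num
  refine squeeze_zero_norm' ((eventually_gt_atTop 0).mono hbound) ?_
  simpa using tendsto_inv_atTop_zero.const_mul (2 / ‖c‖)

/-- Weyl's theorem, for trigonometric polynomials: the averages along a nonresonant linear flow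
converge to the mean. -/
theorem tendsto_average_of_mem_span {μ : Measure (UnitAddTorus d)} [μ.IsAddLeftInvariant]
    [IsProbabilityMeasure μ] {w : d → ℝ} (hw : ∀ n : d → ℤ, n ≠ 0 → ∑ j, (n j : ℝ) * w j ≠ 0)
    {g : C(UnitAddTorus d, ℂ)} (hg : g ∈ Submodule.span ℂ (Set.range (mFourier (d := d)))) :
    Tendsto (fun T : ℝ => (T : ℂ)⁻¹ * ∫ s in (0 : ℝ)..T, g (linearFlow w s))
      atTop (𝓝 (∫ x, g x ∂μ)) := by
  have hint : ∀ (g : C(UnitAddTorus d, ℂ)) (T : ℝ),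
      IntervalIntegrable (fun s => g (linearFlow w s)) volume 0 T := fun g T =>
    (g.continuous.comp (continuous_linearFlow w)).intervalIntegrable _ _
  have hint' : ∀ g : C(UnitAddTorus d, ℂ), Integrable (fun x => g x) μ := fun g =>
    g.continuous.integrable_of_hasCompactSupport (HasCompactSupport.of_compactSpace _)
  induction hg using Submodule.span_induction with
  | mem x hx =>
    obtain ⟨n, rfl⟩ := hx
    by_cases hn : n = 0
    · subst hn
      refine tendsto_const_nhds.congr' ?_
      filter_upwards [eventually_gt_atTop 0] with T hT
      have : (T : ℂ) ≠ 0 := by exact_mod_cast hT.ne'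
      simp [mFourier_zero, this]
    · rw [integral_mFourier_eq_zero (hw n hn)]
      exact tendsto_average_mFourier (hw n hn)
  | zero => simp
  | add f g _ _ hf hg =>
    simp only [ContinuousMap.add_apply]
    rw [integral_add (hint' f) (hint' g)]
    refine (hf.add hg).congr fun T => ?_
    rw [intervalIntegral.integral_add (hint f T) (hint g T), mul_add]
  | smul c f _ hf =>
    simp only [ContinuousMap.smul_apply, smul_eq_mul]
    rw [integral_const_mul]
    refine (hf.const_mul c).congr fun T => ?_
    rw [intervalIntegral.integral_const_mul]
    ring

/-- Kronecker's theorem: a nonresonant linear flow on the torus has a dense orbit. -/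
theorem denseRange_linearFlow {w : d → ℝ}
    (hw : ∀ n : d → ℤ, n ≠ 0 → ∑ j, (n j : ℝ) * w j ≠ 0) : DenseRange (linearFlow w) := by
  intro x₀
  by_contra hx₀
  let μ : Measure (UnitAddTorus d) := Measure.addHaarMeasure ⊤
  have : IsProbabilityMeasure μ := ⟨Measure.addHaarMeasure_self⟩
  obtain ⟨f, hf0, hf1, hf01⟩ := exists_continuous_zero_one_of_isClosed
    (isClosed_closure (s := Set.range (linearFlow w))) (isClosed_singleton (x := x₀))
    (Set.disjoint_singleton_right.2 hx₀)
  have hfpos : 0 < ∫ x, f x ∂μ :=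
    f.continuous.integral_pos_of_hasCompactSupport_nonneg_nonzero
      (HasCompactSupport.of_compactSpace _) (fun x => (hf01 x).1) (x := x₀)
      (by rw [hf1 (Set.mem_singleton x₀)]; exact one_ne_zero)
  set η := ∫ x, f x ∂μ with hη
  let F : C(UnitAddTorus d, ℂ) := ⟨fun x => (f x : ℂ), by fun_prop⟩
  have hF : F ∈ (Submodule.span ℂ (Set.range (mFourier (d := d)))).topologicalClosure := by
    rw [span_mFourier_closure_eq_top]
    trivial
  obtain ⟨g, hg, hFg⟩ := Metric.mem_closure_iff.1 hF (η / 3) (by positivity)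
  have hnear : ∀ x, ‖F x - g x‖ ≤ η / 3 := fun x => by
    rw [← dist_eq_norm]
    exact (ContinuousMap.dist_apply_le_dist x).trans hFg.le
  have hint' : ∀ g : C(UnitAddTorus d, ℂ), Integrable (fun x => g x) μ := fun g =>
    g.continuous.integrable_of_hasCompactSupport (HasCompactSupport.of_compactSpace _)
  have h1 : ‖∫ x, g x ∂μ‖ ≤ η / 3 := by
    refine le_of_tendsto (tendsto_average_of_mem_span (μ := μ) hw hg).norm ?_
    filter_upwards [eventually_gt_atTop 0] with T hT
    have h2 : ‖∫ s in (0 : ℝ)..T, g (linearFlow w s)‖ ≤ η / 3 * |T - 0| := by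
      refine intervalIntegral.norm_integral_le_of_norm_le_const fun s _ => ?_
      have h3 := hnear (linearFlow w s)
      have h4 : F (linearFlow w s) = 0 := by
        simp [F, hf0 (subset_closure (Set.mem_range_self s))]
      rwa [h4, zero_sub, norm_neg] at h3
    rw [norm_mul, norm_inv, Complex.norm_real, norm_eq_abs, abs_of_pos hT, inv_mul_le_iff₀ hT]
    rwa [sub_zero, abs_of_pos hT, mul_comm] at h2
  have h2 : ‖∫ x, F x ∂μ - ∫ x, g x ∂μ‖ ≤ η / 3 := by
    rw [← integral_sub (hint' F) (hint' g)]
    simpa using norm_integral_le_of_norm_le_const (μ := μ) (Eventually.of_forall hnear)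
  have h3 : ∫ x, F x ∂μ = (η : ℂ) := by
    rw [hη]
    exact integral_ofReal
  rw [h3] at h2
  have h4 := norm_sub_norm_le (η : ℂ) (∫ x, g x ∂μ)
  rw [Complex.norm_real, norm_eq_abs, abs_of_pos hfpos] at h4
  linarith

/-- A nonresonant linear flow visits every `ε`-ball in every time interval of a length that depends
on `ε` only. -/
theorem exists_syndetic_linearFlow {w : d → ℝ}
    (hw : ∀ n : d → ℤ, n ≠ 0 → ∑ j, (n j : ℝ) * w j ≠ 0) {ε : ℝ} (hε : 0 < ε) :
    ∃ L : ℝ, ∀ (v : d → ℝ) (T : ℝ), ∃ s, T ≤ s ∧ s ≤ T + L ∧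
      ∃ k : d → ℤ, ∀ j, |s * w j - v j - k j| < ε := by
  let V : ℝ → Set (UnitAddTorus d) := fun s => {x | ∀ j, ‖x j - linearFlow w s j‖ < ε}
  have hV : ∀ s, IsOpen (V s) := fun s => by
    simp only [V, Set.ofPred_forall]
    exact isOpen_iInter_of_finite fun j =>
      isOpen_lt (by fun_prop) continuous_const
  have hcover : (Set.univ : Set (UnitAddTorus d)) ⊆ ⋃ s, V s := by
    intro x _
    have hx := denseRange_linearFlow hw x
    rw [Metric.mem_closure_iff] at hx
    obtain ⟨_, ⟨s, rfl⟩, hs⟩ := hx ε hε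
    refine Set.mem_iUnion.2 ⟨s, fun j => ?_⟩
    rw [← dist_eq_norm]
    exact (dist_le_pi_dist _ _ j).trans_lt hs
  obtain ⟨t, ht⟩ := isCompact_univ.elim_finite_subcover V hV hcover
  obtain ⟨M, hM⟩ := (t.finite_toSet.image fun s : ℝ => |s|).bddAbove
  refine ⟨2 * M, fun v T => ?_⟩
  obtain ⟨s, hst, hs⟩ : ∃ s ∈ t,
      (fun j => ((v j : ℝ) : UnitAddCircle)) - linearFlow w (T + M) ∈ V s := by
    simpa using ht (Set.mem_univ ((fun j => ((v j : ℝ) : UnitAddCircle)) - linearFlow w (T + M)))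
  have hsM := abs_le.1 (hM (Set.mem_image_of_mem _ hst))
  refine ⟨T + M + s, by linarith, by linarith,
    fun j => -round (v j - (T + M + s) * w j), fun j => ?_⟩
  have h1 := hs j
  rw [Pi.sub_apply, sub_sub, ← Pi.add_apply, ← linearFlow_add] at h1
  simp only [linearFlow] at h1
  rw [← AddCircle.coe_sub, UnitAddCircle.norm_eq] at h1
  rw [abs_sub_comm] at h1
  push_cast
  convert h1 using 2
  ring

end Kronecker

/-! ### Independent phases of lacunary waves -/

theorem half_le_cos_of_abs_sub_int_le {x : ℝ} {i : ℤ} (hx : |x - i| ≤ 1 / 6) :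
    1 / 2 ≤ cos (2 * π * x) := by
  have e : 2 * π * x = 2 * π * (x - i) + i * (2 * π) := by ring
  rw [e, cos_add_int_mul_two_pi, ← cos_abs, ← cos_pi_div_three]
  have : |2 * π * (x - i)| ≤ π / 3 := by
    rw [abs_mul, abs_of_pos two_pi_pos]
    nlinarith [pi_pos]
  exact cos_le_cos_of_nonneg_of_le_pi (abs_nonneg _) (by linarith [pi_pos]) this

/-- The phases of a lacunary family of oscillations can be prescribed independently: an arc on
which one of them is near its maximum contains full periods of the next one. -/
theorem exists_forall_half_le_cos {N β : ℕ → ℝ} (hN : ∀ k, 0 < N k)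
    (hN6 : ∀ k, 6 * N k ≤ N (k + 1)) (m : ℕ) : ∀ (K : ℕ) (y₀ : ℝ),
    ∃ y, y₀ ≤ y ∧ y ≤ y₀ + 2 / N K ∧
      ∀ k, K ≤ k → k ≤ K + m → 1 / 2 ≤ cos (2 * π * (N k * y + β k)) := by
  have arc : ∀ (K : ℕ) (y₀ : ℝ), ∃ a, y₀ ≤ a ∧ a + 1 / (3 * N K) ≤ y₀ + 2 / N K ∧
      ∀ y, a ≤ y → y ≤ a + 1 / (3 * N K) → 1 / 2 ≤ cos (2 * π * (N K * y + β K)) := by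
    intro K y₀
    have hK := hN K
    set i := ⌈N K * y₀ + 1 / 6 + β K⌉ with hi
    have h1 : N K * y₀ + 1 / 6 + β K ≤ i := Int.le_ceil _
    have h2 : (i : ℝ) < N K * y₀ + 1 / 6 + β K + 1 := Int.ceil_lt_add_one _
    have e1 : N K * ((i - β K - 1 / 6) / N K) = i - β K - 1 / 6 := by field_simp
    have e2 : N K * (1 / (3 * N K)) = 1 / 3 := by field_simp
    have e3 : N K * (2 / N K) = 2 := by field_simp
    refine ⟨(i - β K - 1 / 6) / N K, ?_, ?_, fun y hy1 hy2 => ?_⟩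
    · refine le_of_mul_le_mul_left ?_ hK
      linarith
    · refine le_of_mul_le_mul_left ?_ hK
      rw [mul_add, mul_add, e1, e2, e3]
      linarith
    · refine half_le_cos_of_abs_sub_int_le (i := i) (abs_le.2 ⟨?_, ?_⟩)
      · have := mul_le_mul_of_nonneg_left hy1 hK.le
        linarith
      · have := mul_le_mul_of_nonneg_left hy2 hK.le
        rw [mul_add] at this
        linarith
  induction m with
  | zero =>
    intro K y₀
    obtain ⟨a, ha1, ha2, ha3⟩ := arc K y₀
    have : 0 < 1 / (3 * N K) := by have := hN K; positivity
    refine ⟨a, ha1, by linarith, fun k hk1 hk2 => ?_⟩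
    obtain rfl : k = K := by omega
    exact ha3 a le_rfl (by linarith)
  | succ m ih =>
    intro K y₀
    obtain ⟨a, ha1, ha2, ha3⟩ := arc K y₀
    obtain ⟨y, hy1, hy2, hy3⟩ := ih (K + 1) a
    have hlen : 2 / N (K + 1) ≤ 1 / (3 * N K) := by
      rw [div_le_div_iff₀ (hN _) (by have := hN K; positivity)]
      linarith [hN6 K]
    refine ⟨y, by linarith, by linarith, fun k hk1 hk2 => ?_⟩
    rcases hk1.eq_or_lt with rfl | hlt
    · exact ha3 y hy1 (by linarith)
    · exact hy3 k hlt (by omega)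

theorem nonresonantBound_nonneg (q' : ℕ → ℕ) : 0 ≤ nonresonantBound q' :=
  tsum_nonneg fun _ => by positivity

theorem continuous_line_uncurry (w : Fin 3 → ℝ) :
    Continuous fun x : (Fin 3 → ℝ) × ℝ => x.1 + x.2 • w := by
  fun_prop

namespace LiouvillePair

variable {α α' : ℝ} {p p' : ℕ → ℤ} {q q' : ℕ → ℕ} (h : LiouvillePair α α' p p' q q')
include h

/-! ### Continuity of the explicit solution -/

theorem continuous_travelTime (w : Fin 3 → ℝ) (s : ℝ) :
    Continuous fun θ => travelTime p q q' w θ s :=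
  intervalIntegral.continuous_parametric_intervalIntegral_of_continuous'
    (f := fun θ u => phi p q q' (θ + u • w))
    (h.continuous_phi.comp (continuous_line_uncurry w)) 0 s

theorem continuous_integral_levelForce (c : ℝ) (j : Fin 3) (w : Fin 3 → ℝ)
    {s : (Fin 3 → ℝ) → ℝ} (hs : Continuous s) :
    Continuous fun θ => ∫ u in (0 : ℝ)..s θ, levelForce p p' q q' c j (θ + u • w) :=
  intervalIntegral.continuous_parametric_intervalIntegral_of_continuous
    (f := fun θ u => levelForce p p' q q' c j (θ + u • w))
    ((h.continuous_levelForce c j).comp (continuous_line_uncurry w)) hs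

theorem continuous_advance (w : Fin 3 → ℝ) (t : ℝ) :
    Continuous fun θ => advance p q q' w θ t := by
  refine continuous_iff_continuousAt.2 fun θ₀ => ?_
  rw [ContinuousAt, tendsto_iff_dist_tendsto_zero]
  have h1 : Tendsto (fun θ => 5 / 2 * |t - travelTime p q q' w θ (advance p q q' w θ₀ t)|)
      (𝓝 θ₀) (𝓝 0) := by
    have h2 : Continuous fun θ =>
        5 / 2 * |t - travelTime p q q' w θ (advance p q q' w θ₀ t)| :=
      continuous_const.mul (continuous_const.sub (h.continuous_travelTime w _)).abs
    have h3 := h2.tendsto θ₀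
    rwa [h.travelTime_advance, sub_self, abs_zero, mul_zero] at h3
  refine squeeze_zero (fun _ => dist_nonneg) (fun θ => ?_) h1
  have := h.abs_sub_le_travelTime w θ (advance p q q' w θ₀ t) (advance p q q' w θ t)
  rw [h.travelTime_advance] at this
  rw [dist_eq]
  linarith

/-! ### The displacements as sums over resonances -/

theorem hasSum_travelTime (x y z s : ℝ) :
    HasSum (fun k => phiAmp q q' k * osc (q k * x - p k * z) (1 * (q k * α - p k)) s)
      (travelTime p q q' (freq α α') ![x, y, z] s - s) := by
  have h1 := hasSum_integral_trigSeries h.rapidDecay_phi 0 ![x, y, z] (freq α α') s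
  have e : travelTime p q q' (freq α α') ![x, y, z] s - s = ∫ u in (0 : ℝ)..s,
      trigSeries (phiAmp q q') (phiFreq p q) 0 (![x, y, z] + u • freq α α') := by
    rw [travelTime, phi_eq, intervalIntegral.integral_add intervalIntegrable_const]
    · simp
    · exact ((continuous_trigSeries h.rapidDecay_phi 0).comp
        (continuous_line _ _)).intervalIntegrable _ _
  rw [e]
  refine h1.congr_fun fun k => ?_
  simp only [phiFreq, freq, dotProduct, Fin.sum_univ_three, Matrix.cons_val]
  ring_nf

theorem integral_levelForce_eq (c : ℝ) (j : Fin 3) (θ w : Fin 3 → ℝ) (s : ℝ) :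
    ∫ u in (0 : ℝ)..s, levelForce p p' q q' c j (θ + u • w) =
      c * (∫ u in (0 : ℝ)..s, trigSeries (fun n => 2 * π * phiAmp q q' n * phiFreq p q n j)
        (phiFreq p q) (0 + 1 / 4) (θ + u • w)) +
      (∫ u in (0 : ℝ)..s, trigSeries (fun n => 2 * π * hAmp q q' n * hFreq p q n j)
        (hFreq p q) (0 + 1 / 4) (θ + u • w)) +
      ∫ u in (0 : ℝ)..s, trigSeries (fun n => 2 * π * hAmp' q' n * hFreq' p' q' n j)
        (hFreq' p' q') (0 + 1 / 4) (θ + u • w) := by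
  have hint : ∀ {a m}, RapidDecay a m → IntervalIntegrable (fun u =>
      trigSeries (fun n => 2 * π * a n * m n j) m (0 + 1 / 4) (θ + u • w))
      MeasureTheory.volume 0 s := fun ha =>
    ((continuous_trigSeries (ha.partialDeriv j) (0 + 1 / 4)).comp
      (continuous_line θ w)).intervalIntegrable 0 s
  have i1 := (hint h.rapidDecay_phi).const_mul c
  have i2 := hint h.rapidDecay_h
  have i3 := hint h.rapidDecay_h'
  rw [← intervalIntegral.integral_const_mul, ← intervalIntegral.integral_add i1 i2,
    ← intervalIntegral.integral_add (i1.add i2) i3]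
  rfl

/-- The displacement of `r₁` is the sum of the contributions of `φ` and of the resonant part of
`h̃` in `(θ₁, θ₃)`. -/
theorem exists_hasSum_levelForce_zero (c x y z s : ℝ) : ∃ S₁ S₂ : ℝ,
    ∫ u in (0 : ℝ)..s, levelForce p p' q q' c 0 (![x, y, z] + u • freq α α') = c * S₁ + S₂ ∧
    HasSum (fun k => 2 * π * ((q k : ℝ) ^ 2 * exp (-(q' k : ℝ))) *
      osc (q k * x - p k * z + 1 / 4) (1 * (q k * α - p k)) s) S₁ ∧
    HasSum (fun k => 2 * π * ((q k : ℝ) ^ 5 * exp (-(q' k : ℝ))) *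
      osc ((q k : ℝ) ^ 2 * (q k * x - p k * z) + 1 / 4) ((q k : ℝ) ^ 2 * (q k * α - p k)) s)
      S₂ := by
  have h1 := hasSum_integral_trigSeries (h.rapidDecay_phi.partialDeriv 0) (0 + 1 / 4) ![x, y, z]
    (freq α α') s
  have h2 := hasSum_integral_trigSeries (h.rapidDecay_h.partialDeriv 0) (0 + 1 / 4) ![x, y, z]
    (freq α α') s
  refine ⟨_, _, ?_, h1.congr_fun fun k => ?_, h2.congr_fun fun k => ?_⟩
  · rw [h.integral_levelForce_eq]
    simp [hFreq', trigSeries]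
  · simp only [phiAmp, phiFreq, freq, dotProduct, Fin.sum_univ_three, Matrix.cons_val]
    ring_nf
  · simp only [hAmp, hFreq, freq, dotProduct, Fin.sum_univ_three, Matrix.cons_val]
    ring_nf

theorem hasSum_levelForce_one (c x y z s : ℝ) :
    HasSum (fun k => 2 * π * (q' k * exp (-(q' k : ℝ))) *
      osc (q' k * y - p' k * z + 1 / 4) (q' k * α' - p' k) s)
      (∫ u in (0 : ℝ)..s, levelForce p p' q q' c 1 (![x, y, z] + u • freq α α')) := by
  have h1 := hasSum_integral_trigSeries (h.rapidDecay_h'.partialDeriv 1) (0 + 1 / 4) ![x, y, z]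
    (freq α α') s
  have e : ∫ u in (0 : ℝ)..s, levelForce p p' q q' c 1 (![x, y, z] + u • freq α α') =
      ∫ u in (0 : ℝ)..s, trigSeries (fun n => 2 * π * hAmp' q' n * hFreq' p' q' n 1)
        (hFreq' p' q') (0 + 1 / 4) (![x, y, z] + u • freq α α') := by
    rw [h.integral_levelForce_eq]
    simp [phiFreq, hFreq, trigSeries]
  rw [e]
  refine h1.congr_fun fun k => ?_
  simp only [hAmp', hFreq', freq, dotProduct, Fin.sum_univ_three, Matrix.cons_val]
  ring_nf

/-- The angle `θ₂` affects neither the length covered nor the displacement of `r₁`. -/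
theorem travelTime_congr (x y y' z s : ℝ) :
    travelTime p q q' (freq α α') ![x, y, z] s = travelTime p q q' (freq α α') ![x, y', z] s := by
  have := (h.hasSum_travelTime x y z s).unique (h.hasSum_travelTime x y' z s)
  linarith

theorem integral_levelForce_zero_congr (c x y y' z s : ℝ) :
    ∫ u in (0 : ℝ)..s, levelForce p p' q q' c 0 (![x, y, z] + u • freq α α') =
      ∫ u in (0 : ℝ)..s, levelForce p p' q q' c 0 (![x, y', z] + u • freq α α') := by
  obtain ⟨S₁, S₂, e, h1, h2⟩ := h.exists_hasSum_levelForce_zero (p' := p') c x y z s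
  obtain ⟨S₁', S₂', e', h1', h2'⟩ := h.exists_hasSum_levelForce_zero (p' := p') c x y' z s
  rw [e, e', h1.unique h1', h2.unique h2']

/-! ### Estimates at the times `e^{q'ₙ}` -/

/-- For large `n`, the `n`-th resonance and its multiples up to `q'ₙ` turn by less than a sixth of a
period until time `3e^{q'ₙ}`. -/
theorem abs_mul_approx_le {n : ℕ} (hn : 3 * (q' n * exp (-(q' n : ℝ))) ≤ 1 / 6) {s κ : ℝ}
    (hs : 0 ≤ s) (hs' : s ≤ 3 * exp (q' n)) (hκ : 0 ≤ κ) (hκ' : κ ≤ q' n) :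
    |κ * (q n * α - p n)| * s ≤ 1 / 6 := by
  refine le_trans ?_ hn
  rw [abs_mul, abs_of_nonneg hκ]
  calc κ * |q n * α - p n| * s ≤ q' n * exp (-(2 * q' n : ℝ)) * (3 * exp (q' n)) := by
        gcongr
        exact h.approx n
    _ = 3 * (q' n * (exp (-(2 * q' n : ℝ)) * exp (q' n))) := by ring
    _ = _ := by rw [← exp_add]; ring_nf

/-- Moving `θ₁` changes the travel time through the `n`-th resonance of `φ` only, up to a bounded
multiple of the number `qₙ |x' - x|` of periods. -/
theorem abs_travelTime_sub_sub_le (n : ℕ) {s : ℝ} (hs : 0 ≤ s) (hs' : s ≤ 3 * exp (q' n))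
    (x x' y z : ℝ) :
    |travelTime p q q' (freq α α') ![x', y, z] s - travelTime p q q' (freq α α') ![x, y, z] s -
      (phiAmp q q' n * osc (q n * x' - p n * z) (1 * (q n * α - p n)) s -
        phiAmp q q' n * osc (q n * x - p n * z) (1 * (q n * α - p n)) s)| ≤
      2 * π * |x' - x| * (q n * nonresonantBound q') := by
  have hsum := (h.hasSum_travelTime x' y z s).sub (h.hasSum_travelTime x y z s)
  have key := h.abs_hasSum_sub_le (n := n) hs hs' (M := 2 * π * |x' - x|) (by positivity)
    (u := fun k => q k * x - p k * z + q k * (x' - x) / 2 + 1 / 4) (κ := fun _ => 1)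
    (fun _ => le_rfl) hsum fun k => ?_
  · convert key using 2
    ring
  · have e : (q k : ℝ) * x' - p k * z = q k * x - p k * z + q k * (x' - x) := by ring
    have h1 := abs_osc_add_sub_osc_le (q k * x - p k * z) (q k * (x' - x))
      (1 * (q k * α - p k)) s
    have h2 : (q k : ℝ) * q k ≤ (q' k : ℝ) ^ 2 := by
      have := h.le' k
      nlinarith [h.one_le k]
    rw [← mul_sub, abs_mul, e, phiAmp, abs_of_nonneg (by positivity)]
    calc _ ≤ q k * exp (-(q' k : ℝ)) * (2 * π * |q k * (x' - x)| *
          |osc (q k * x - p k * z + q k * (x' - x) / 2 + 1 / 4) (1 * (q k * α - p k)) s|) := by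
          gcongr
      _ = 2 * π * |x' - x| * (q k * q k * exp (-(q' k : ℝ)) *
          |osc (q k * x - p k * z + q k * (x' - x) / 2 + 1 / 4) (1 * (q k * α - p k)) s|) := by
          rw [abs_mul, Nat.abs_cast]
          ring
      _ ≤ _ := by gcongr

theorem abs_travelTime_sub_le (n : ℕ) {s : ℝ} (hs : 0 ≤ s) (hs' : s ≤ 3 * exp (q' n))
    (x x' y z : ℝ) :
    |travelTime p q q' (freq α α') ![x', y, z] s - travelTime p q q' (freq α α') ![x, y, z] s| ≤
      2 * π * |x' - x| * ((nonresonantBound q' + 3) * (q n : ℝ) ^ 2) := by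
  have h1 := h.abs_travelTime_sub_sub_le n hs hs' x x' y z
  have e : (q n : ℝ) * x' - p n * z = q n * x - p n * z + q n * (x' - x) := by ring
  have h2 := abs_osc_add_sub_osc_le (q n * x - p n * z) (q n * (x' - x)) (1 * (q n * α - p n)) s
  have h3 := (abs_osc_le (q n * x - p n * z + q n * (x' - x) / 2 + 1 / 4)
    (1 * (q n * α - p n)) hs).trans hs'
  rw [← e, abs_mul, Nat.abs_cast] at h2
  have h4 : |phiAmp q q' n * osc (q n * x' - p n * z) (1 * (q n * α - p n)) s -
        phiAmp q q' n * osc (q n * x - p n * z) (1 * (q n * α - p n)) s| ≤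
      2 * π * |x' - x| * (3 * (q n : ℝ) ^ 2) := by
    rw [← mul_sub, abs_mul, phiAmp, abs_of_nonneg (by positivity)]
    calc _ ≤ q n * exp (-(q' n : ℝ)) * (2 * π * (q n * |x' - x|) * (3 * exp (q' n))) := by
          refine mul_le_mul_of_nonneg_left (h2.trans ?_) (by positivity)
          gcongr
      _ = 2 * π * |x' - x| * (3 * (q n : ℝ) ^ 2) * (exp (-(q' n : ℝ)) * exp (q' n)) := by ring
      _ = _ := by rw [← exp_add, neg_add_cancel, exp_zero, mul_one]
  have h5 := h.one_le n
  have h6 : (q n : ℝ) * nonresonantBound q' ≤ (q n : ℝ) ^ 2 * nonresonantBound q' := by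
    have := nonresonantBound_nonneg q'
    gcongr
    nlinarith
  have h7 : 2 * π * |x' - x| * (q n * nonresonantBound q') ≤
      2 * π * |x' - x| * ((q n : ℝ) ^ 2 * nonresonantBound q') := by gcongr
  have h8 := abs_add_le _ _ |>.trans (add_le_add h1 h4)
  rw [sub_add_cancel] at h8
  linarith

/-- The travel time of a segment drops by a definite amount as its starting point moves from a crest
of the `n`-th resonance of `φ` to the next trough. -/
theorem travelTime_crest_sub_trough {n : ℕ} (hn : 3 * (q' n * exp (-(q' n : ℝ))) ≤ 1 / 6) {s : ℝ}
    (hs : 0 ≤ s) (hs' : s ≤ 3 * exp (q' n)) {x z : ℝ} (y : ℝ) {i : ℤ}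
    (hx : q n * x - p n * z = i) :
    q n * exp (-(q' n : ℝ)) * s - π * nonresonantBound q' ≤
      travelTime p q q' (freq α α') ![x, y, z] s -
        travelTime p q q' (freq α α') ![x + 1 / (2 * q n), y, z] s := by
  have hq : (0 : ℝ) < q n := zero_lt_one.trans_le (h.one_le n)
  have h1 := h.abs_travelTime_sub_sub_le n hs hs' x (x + 1 / (2 * q n)) y z
  have e : (q n : ℝ) * (x + 1 / (2 * q n)) - p n * z = i + 1 / 2 := by
    rw [← hx]
    field_simp
    ring
  have h2 := half_le_osc_int i hs
    (h.abs_mul_approx_le hn hs hs' zero_le_one (h.one_le' n))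
  have h3 : 2 * π * |x + 1 / (2 * q n) - x| * (q n * nonresonantBound q') =
      π * nonresonantBound q' := by
    rw [add_sub_cancel_left, abs_of_pos (by positivity)]
    field_simp
  rw [e, osc_add_half, hx, h3, phiAmp] at h1
  have h4 : q n * exp (-(q' n : ℝ)) * (s / 2) ≤
      q n * exp (-(q' n : ℝ)) * osc i (1 * (q n * α - p n)) s := by gcongr
  linarith [(abs_le.1 h1).2]

/-- The displacement of `r₁` is that of the `n`-th resonance of `h̃`, of size `qₙ⁵`, up to
`O(qₙ²)`. -/
theorem abs_integral_levelForce_zero_sub_le (c : ℝ) (n : ℕ) {s : ℝ} (hs : 0 ≤ s)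
    (hs' : s ≤ 3 * exp (q' n)) (x y z : ℝ) :
    |(∫ u in (0 : ℝ)..s, levelForce p p' q q' c 0 (![x, y, z] + u • freq α α')) -
      2 * π * ((q n : ℝ) ^ 5 * exp (-(q' n : ℝ))) *
      osc ((q n : ℝ) ^ 2 * (q n * x - p n * z) + 1 / 4) ((q n : ℝ) ^ 2 * (q n * α - p n)) s| ≤
      2 * π * (|c| * (nonresonantBound q' + 3) + nonresonantBound q') * (q n : ℝ) ^ 2 := by
  obtain ⟨S₁, S₂, e, h1, h2⟩ := h.exists_hasSum_levelForce_zero (p' := p') c x y z s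
  have hq := h.one_le n
  have hD := nonresonantBound_nonneg q'
  have b1 := h.abs_hasSum_sub_le (n := n) hs hs' (M := 2 * π) (by positivity)
    (κ := fun _ => 1) (fun _ => le_rfl) h1 fun k => by
      rw [abs_mul, abs_of_nonneg (by positivity), mul_assoc]
      gcongr
      exact_mod_cast h.le' k
  have b2 := h.abs_hasSum_sub_le (n := n) hs hs' (M := 2 * π) (by positivity)
    (κ := fun k => (q k : ℝ) ^ 2) (fun k => one_le_pow₀ (h.one_le k)) h2 fun k => by
      rw [abs_mul, abs_of_nonneg (by positivity), mul_assoc]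
      gcongr
      have h3 := h.le' k
      have h4 := h.pow_four_le k
      have h5 : (q k : ℝ) ^ 4 * q k ≤ q' k * q' k := by gcongr
      linarith [pow_succ (q k : ℝ) 4, sq (q' k : ℝ)]
  have b3 : |2 * π * ((q n : ℝ) ^ 2 * exp (-(q' n : ℝ))) *
      osc (q n * x - p n * z + 1 / 4) (1 * (q n * α - p n)) s| ≤ 2 * π * (3 * (q n : ℝ) ^ 2) := by
    rw [abs_mul, abs_of_nonneg (by positivity)]
    calc _ ≤ 2 * π * ((q n : ℝ) ^ 2 * exp (-(q' n : ℝ))) * (3 * exp (q' n)) := by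
          gcongr
          exact (abs_osc_le _ _ hs).trans hs'
      _ = 2 * π * (3 * (q n : ℝ) ^ 2) * (exp (-(q' n : ℝ)) * exp (q' n)) := by ring
      _ = _ := by rw [← exp_add, neg_add_cancel, exp_zero, mul_one]
  have hqq : (q n : ℝ) * nonresonantBound q' ≤ (q n : ℝ) ^ 2 * nonresonantBound q' := by
    gcongr
    nlinarith
  have b4 : |S₁| ≤ 2 * π * ((nonresonantBound q' + 3) * (q n : ℝ) ^ 2) := by
    have := abs_add_le _ _ |>.trans (add_le_add b1 b3)
    rw [sub_add_cancel] at this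
    refine this.trans ?_
    rw [← mul_add]
    gcongr
    linarith
  rw [e, add_sub_assoc]
  refine (abs_add_le _ _).trans ?_
  rw [abs_mul]
  calc _ ≤ |c| * (2 * π * ((nonresonantBound q' + 3) * (q n : ℝ) ^ 2)) +
        2 * π * ((q n : ℝ) ^ 2 * nonresonantBound q') := by
        gcongr
        exact b2.trans (by gcongr)
    _ = _ := by ring

/-- The lower bound for the displacement of `r₂`, in the direction of the sign `σ`: in the sum over
the resonances in `(θ₂, θ₃)`, the first `K₀` terms are bounded, the terms from `K₀` to `n` have
the right sign for a suitable `θ₂`, the `K`-th one is large, and the terms after the `n`-th are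
small. -/
theorem exists_le_integral_levelForce_one (c : ℝ) {K₀ K n : ℕ} (hK : K₀ ≤ K) (hKn : K ≤ n)
    {s : ℝ} (hs : 0 ≤ s) (hs' : s ≤ 3 * exp (q' n))
    (hsin : 1 / 2 ≤ |sin (π * ((q' K * α' - p' K) * s))|) (x y₀ z : ℝ) {σ : ℝ} (hσ : |σ| = 1) :
    ∃ y, y₀ ≤ y ∧ y ≤ y₀ + 2 / q' K₀ ∧
      (q' K : ℝ) / 2 - (∑ k ∈ Finset.range K₀,
        2 * (q' k * exp (-(q' k : ℝ)) / |q' k * α' - p' k|)) - 2 * π * nonresonantBound q' ≤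
      σ * ∫ u in (0 : ℝ)..s, levelForce p p' q q' c 1 (![x, y, z] + u • freq α α') := by
  set δ : ℕ → ℝ := fun k => q' k * α' - p' k with hδ
  set A : ℕ → ℝ := fun k => sin (π * (δ k * s)) / (π * δ k) with hA
  have hδ0 : ∀ k, δ k ≠ 0 := h.approx_ne_zero'
  -- An additional half turn where the amplitude has the wrong sign.
  set τ : ℕ → ℝ := fun k => if 0 ≤ σ * A k then 0 else 1 / 2 with hτ
  obtain ⟨y, hy1, hy2, hy3⟩ := exists_forall_half_le_cos (N := fun k => (q' k : ℝ))
    (β := fun k => -p' k * z + 1 / 4 + δ k * s / 2 + τ k)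
    (fun k => zero_lt_one.trans_le (h.one_le' k)) (fun k => h.six_mul_le k.lt_succ_self)
    (n - K₀) K₀ y₀
  refine ⟨y, hy1, hy2, ?_⟩
  set b : ℕ → ℝ := fun k => σ * (2 * π * (q' k * exp (-(q' k : ℝ))) *
      osc (q' k * y - p' k * z + 1 / 4) (δ k) s) with hb
  have hbsum := (h.hasSum_levelForce_one c x y z s).mul_left σ
  have habs : ∀ k, |b k| = 2 * π * (q' k * exp (-(q' k : ℝ))) *
      |osc (q' k * y - p' k * z + 1 / 4) (δ k) s| := fun k => by
    rw [hb]
    simp only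
    rw [abs_mul, hσ, one_mul, abs_mul, abs_of_nonneg (by positivity)]
  have hlow : ∀ k, k < K₀ → -(2 * (q' k * exp (-(q' k : ℝ)) / |δ k|)) ≤ b k := fun k _ => by
    refine neg_le_of_abs_le ?_
    rw [habs]
    calc _ ≤ 2 * π * (q' k * exp (-(q' k : ℝ))) * (1 / (π * |δ k|)) := by
          gcongr
          exact abs_osc_le_inv (hδ0 k) _ _
      _ = _ := by field_simp
  have hmid : ∀ k, K₀ ≤ k → k ≤ n → π * (q' k * exp (-(q' k : ℝ))) * |A k| ≤ b k := by
    intro k hk1 hk2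
    have hcos := hy3 k hk1 (by omega)
    have hosc : σ * osc (q' k * y - p' k * z + 1 / 4) (δ k) s =
        |A k| * cos (2 * π * (q' k * y + (-p' k * z + 1 / 4 + δ k * s / 2 + τ k))) := by
      rw [osc_eq (hδ0 k), ← mul_assoc]
      change σ * A k * _ = _
      by_cases hpos : 0 ≤ σ * A k
      · have e : σ * A k = |A k| := by rw [← abs_of_nonneg hpos, abs_mul, hσ, one_mul]
        rw [e]
        simp only [hτ, if_pos hpos]
        ring_nf
      · have e : σ * A k = -|A k| := by
          rw [← neg_eq_iff_eq_neg, ← abs_of_neg (not_le.1 hpos), abs_mul, hσ, one_mul]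
        rw [e, neg_mul, ← mul_neg, ← cos_add_pi]
        simp only [hτ, if_neg hpos]
        ring_nf
    have e : b k = 2 * π * (q' k * exp (-(q' k : ℝ))) *
        (σ * osc (q' k * y - p' k * z + 1 / 4) (δ k) s) := by
      rw [hb]
      ring
    rw [e, hosc]
    calc _ = 2 * π * (q' k * exp (-(q' k : ℝ))) * (|A k| * (1 / 2)) := by ring
      _ ≤ _ := by gcongr
  have hAK : (q' K : ℝ) / 2 ≤ π * (q' K * exp (-(q' K : ℝ))) * |A K| := by
    have h1 : exp (q' K) ≤ 1 / |δ K| := by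
      rw [le_div_iff₀ (abs_pos.2 (hδ0 K)), ← le_div_iff₀' (exp_pos _), one_div, ← exp_neg]
      exact h.approx' K
    have h2 : 1 / 2 * exp (q' K) / π ≤ |A K| := by
      rw [hA]
      simp only
      rw [abs_div, abs_mul, abs_of_pos pi_pos]
      calc 1 / 2 * exp (q' K) / π ≤ 1 / 2 * (1 / |δ K|) / π := by gcongr
        _ = (1 / 2) / (π * |δ K|) := by have := abs_pos.2 (hδ0 K); field_simp
        _ ≤ _ := by gcongr
    calc (q' K : ℝ) / 2 = q' K / 2 * (exp (-(q' K : ℝ)) * exp (q' K)) := by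
          rw [← exp_add, neg_add_cancel, exp_zero, mul_one]
      _ = π * (q' K * exp (-(q' K : ℝ))) * (1 / 2 * exp (q' K) / π) := by field_simp
      _ ≤ _ := by gcongr
  have hhigh : ∀ k, n < k → -(2 * π * (3 * ((q' k : ℝ) ^ 2 * exp (-(q' k : ℝ) / 2)))) ≤ b k := by
    intro k hk
    refine neg_le_of_abs_le ?_
    have hq' := h.one_le' k
    rw [habs]
    calc _ ≤ 2 * π * ((q' k : ℝ) ^ 2 * exp (-(q' k : ℝ))) * (3 * exp ((q' k : ℝ) / 2)) := by
          gcongr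
          · nlinarith
          · refine (abs_osc_le _ _ hs).trans (hs'.trans ?_)
            gcongr
            linarith [h.six_mul_le hk, h.one_le' n]
      _ = 2 * π * (3 * ((q' k : ℝ) ^ 2 * (exp (-(q' k : ℝ)) * exp ((q' k : ℝ) / 2)))) := by ring
      _ = _ := by rw [← exp_add]; ring_nf
  have hf := hasSum_sum_of_ne_finset_zero (L := SummationFilter.unconditional ℕ)
    (s := Finset.range K₀)
    (f := fun k => if k < K₀ then 2 * (q' k * exp (-(q' k : ℝ)) / |δ k|) else 0)
    fun k hk => if_neg (by simpa using hk)
  have hg := hasSum_ite_eq K ((q' K : ℝ) / 2)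
  have hd := (((h.summable_weight 2).mul_left 3).hasSum).mul_left (2 * π)
  have hle := hasSum_le (fun k => ?_) ((hg.sub hf).sub hd) hbsum
  · refine le_trans (le_of_eq ?_) hle
    rw [nonresonantBound]
    congr 2
    exact Finset.sum_congr rfl fun k hk => by rw [if_pos (Finset.mem_range.1 hk)]
  · change _ ≤ b k
    have h0 : 0 ≤ 2 * π * (3 * ((q' k : ℝ) ^ 2 * exp (-(q' k : ℝ) / 2))) := by positivity
    rcases lt_or_ge k K₀ with hk | hk
    · rw [if_neg (by omega), if_pos hk]
      linarith [hlow k hk]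
    · rw [if_neg (by omega : ¬ k < K₀)]
      rcases le_or_gt k n with hkn | hkn
      · by_cases hkK : k = K
        · subst hkK
          rw [if_pos rfl]
          linarith [hmid k hk hkn]
        · rw [if_neg hkK]
          have : 0 ≤ π * (q' k * exp (-(q' k : ℝ))) * |A k| := by positivity
          linarith [hmid k hk hkn]
      · rw [if_neg (by omega)]
        linarith [hhigh k hkn]

end LiouvillePair

/-! ### Mixing on energy surfaces -/

/-- The energy surface is a graph over the angles and `(r₁, r₂)`: the actions of the point of
`{H̃ = c}` with angles `θ`, `r₁ = a` and `r₂ = b`. -/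
noncomputable def surfaceAction (α α' : ℝ) (p p' : ℕ → ℤ) (q q' : ℕ → ℕ) (c a b : ℝ)
    (θ : Fin 3 → ℝ) : Fin 3 → ℝ :=
  ![a, b, levelFn p p' q q' c θ - a * α - b * α']

theorem surfaceAction_add_int (α α' : ℝ) (p p' : ℕ → ℤ) (q q' : ℕ → ℕ) (c a b : ℝ)
    (θ : Fin 3 → ℝ) (k : Fin 3 → ℤ) :
    surfaceAction α α' p p' q q' c a b (fun j => θ j + k j) =
      surfaceAction α α' p p' q q' c a b θ := by
  simp only [surfaceAction, levelFn_add_int]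

theorem continuous_toTorus : Continuous toTorus :=
  continuous_pi fun j => (AddCircle.continuous_mk' 1).comp (continuous_apply j)

theorem half_le_abs_sin_of_abs_sub_le {x : ℝ} {i : ℤ} (hx : |x - i - 1 / 2| ≤ 1 / 4) :
    1 / 2 ≤ |sin (π * x)| := by
  have e : π * x = π / 2 + π * (x - i - 1 / 2) + i * π := by ring
  rw [e, sin_add_int_mul_pi, abs_mul, abs_zpow, abs_neg, abs_one, one_zpow, one_mul, add_comm,
    sin_add_pi_div_two]
  refine le_trans ?_ (le_abs_self _)
  rw [← cos_abs]
  refine cos_pi_div_three.symm.le.trans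
    (cos_le_cos_of_nonneg_of_le_pi (abs_nonneg _) (by linarith [pi_pos]) ?_)
  rw [abs_mul, abs_of_pos pi_pos]
  nlinarith [pi_pos]

/-- Within distance `1 / N` of `y'` there is a point for which a wave of frequency `N` arrives with
half a turn of phase difference. -/
theorem exists_half_turn {N : ℝ} (hN : 0 < N) (P y y' d : ℝ) :
    ∃ (x : ℝ) (i : ℤ), N * (x - y) - P * d = i + 1 / 2 ∧ |x - y'| ≤ 1 / N := by
  set i := round (N * (y' - y) - P * d - 1 / 2) with hi
  have h1 := abs_sub_round (N * (y' - y) - P * d - 1 / 2)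
  rw [← hi] at h1
  refine ⟨y + (i + 1 / 2 + P * d) / N, i, by field_simp; ring, ?_⟩
  have e : y + (i + 1 / 2 + P * d) / N - y' = -(N * (y' - y) - P * d - 1 / 2 - i) / N := by
    field_simp
    ring
  rw [e, abs_div, abs_neg, abs_of_pos hN]
  gcongr
  linarith

theorem abs_add_four_lt {a b c d ρ : ℝ} (ha : |a| ≤ ρ) (hb : |b| ≤ ρ) (hc : |c| < ρ)
    (hd : |d| ≤ ρ) : |a + b + c + d| < 4 * ρ := by
  have h1 := abs_add_le a b
  have h2 := abs_add_le (a + b) c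
  have h3 := abs_add_le (a + b + c) d
  linarith

namespace LiouvillePair

variable {α α' : ℝ} {p p' : ℕ → ℤ} {q q' : ℕ → ℕ} (h : LiouvillePair α α' p p' q q')
include h

theorem tildeH_eq_iff_surfaceAction (c : ℝ) (θ r : Fin 3 → ℝ) :
    tildeH α α' p p' q q' (θ, r) = c ↔ r = surfaceAction α α' p p' q q' c (r 0) (r 1) θ := by
  rw [h.tildeH_eq_iff, funext_iff, Fin.forall_fin_succ, Fin.forall_fin_two]
  simp only [Fin.sum_univ_three, freq, surfaceAction, Matrix.cons_val, Fin.succ_zero_eq_one,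
    Fin.succ_one_eq_two, true_and]
  constructor <;> intro h1 <;> linarith

theorem mem_energySurface_surfaceAction (c a b : ℝ) (θ : Fin 3 → ℝ) :
    (toTorus θ, surfaceAction α α' p p' q q' c a b θ) ∈ energySurface (tildeH α α' p p' q q') c :=
  ⟨θ, rfl, (h.tildeH_eq_iff_surfaceAction c θ _).2 (by simp [surfaceAction])⟩

/-- A nonempty relatively open subset of the energy surface contains a neighbourhood of angles for
some fixed `(r₁, r₂)`. -/
theorem exists_mem_of_isRelOpen {c : ℝ} {A : Set Phase}
    (hA : IsRelOpen (energySurface (tildeH α α' p p' q q') c) A) (hne : A.Nonempty) :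
    ∃ (θ₀ : Fin 3 → ℝ) (a b ε : ℝ), 0 < ε ∧ ∀ θ : Fin 3 → ℝ, (∀ j, |θ j - θ₀ j| < ε) →
      (toTorus θ, surfaceAction α α' p p' q q' c a b θ) ∈ A := by
  obtain ⟨U, hU, rfl⟩ := hA
  obtain ⟨⟨z, r⟩, ⟨θ₀, rfl, hE⟩, hzU⟩ := hne
  simp only at hE hzU
  have hr := (h.tildeH_eq_iff_surfaceAction c θ₀ r).1 hE
  have hcont : Continuous fun θ =>
      ((toTorus θ, surfaceAction α α' p p' q q' c (r 0) (r 1) θ) : Phase) := by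
    refine continuous_toTorus.prodMk (continuous_pi fun j => ?_)
    have := h.continuous_levelFn c
    fin_cases j
    · exact continuous_const
    · exact continuous_const
    · exact (this.sub continuous_const).sub continuous_const
  rw [hr] at hzU
  obtain ⟨ε, hε, hball⟩ := Metric.isOpen_iff.1 (hU.preimage hcont) θ₀ hzU
  refine ⟨θ₀, r 0, r 1, ε, hε, fun θ hθ => ⟨h.mem_energySurface_surfaceAction _ _ _ _, ?_⟩⟩
  exact hball (Metric.mem_ball.2 ((dist_pi_lt_iff hε).2 fun j => by rw [dist_eq]; exact hθ j))

theorem advance_mem (w θ : Fin 3 → ℝ) {t : ℝ} (ht : 0 < t) :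
    t / 3 ≤ advance p q q' w θ t ∧ advance p q q' w θ t ≤ 3 * t := by
  have h0 := travelTime_zero (p := p) (q := q) (q' := q') w θ
  have h1 := h.travelTime_advance w θ t
  rcases le_total 0 (advance p q q' w θ t) with hs | hs
  · have := h.travelTime_sub_mem w θ hs
    rw [h0, h1] at this
    constructor <;> linarith
  · have := h.travelTime_sub_mem w θ hs
    rw [h0, h1] at this
    linarith

/-- A small interval of `θ₁` is stretched along the flow: within time `e^{q'ₙ}` the lengths covered
from its points differ by a multiple of `qₙ`. -/
theorem exists_advance_add_le {n : ℕ} (hn : 3 * (q' n * exp (-(q' n : ℝ))) ≤ 1 / 6) {L : ℝ}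
    (hL : 0 ≤ L) (hbig : 5 * L + 4 * (π * nonresonantBound q') + 1 ≤ q n) (x y z : ℝ) :
    ∃ a b, x ≤ a ∧ a ≤ b ∧ b ≤ x + 2 / q n ∧
      advance p q q' (freq α α') ![a, y, z] (exp (q' n)) + L ≤
        advance p q q' (freq α α') ![b, y, z] (exp (q' n)) := by
  have hq : (0 : ℝ) < q n := zero_lt_one.trans_le (h.one_le n)
  have hD := mul_nonneg pi_pos.le (nonresonantBound_nonneg q')
  set i := ⌈q n * x - p n * z⌉ with hi
  have h1 : q n * x - p n * z ≤ i := Int.le_ceil _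
  have h2 : (i : ℝ) < q n * x - p n * z + 1 := Int.ceil_lt_add_one _
  set a := (i + p n * z) / q n with ha
  have hqa : q n * a = i + p n * z := by rw [ha]; field_simp
  have hqb : q n * (1 / (2 * q n)) = (1 / 2 : ℝ) := by field_simp
  refine ⟨a, a + 1 / (2 * q n), le_of_mul_le_mul_left (by linarith) hq,
    by linarith [show (0 : ℝ) < 1 / (2 * q n) by positivity], ?_, ?_⟩
  · refine le_of_mul_le_mul_left ?_ hq
    have e : q n * (2 / q n) = (2 : ℝ) := by field_simp
    rw [mul_add, mul_add, hqa, hqb, e]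
    linarith
  set sa := advance p q q' (freq α α') ![a, y, z] (exp (q' n)) with hsa
  set sb := advance p q q' (freq α α') ![a + 1 / (2 * q n), y, z] (exp (q' n)) with hsb
  obtain ⟨hs1, hs2⟩ := h.advance_mem (freq α α') ![a, y, z] (exp_pos (q' n))
  rw [← hsa] at hs1 hs2
  have hdrop := h.travelTime_crest_sub_trough hn (by linarith [exp_pos (q' n : ℝ)]) hs2 (x := a)
    (z := z) y (i := i) (by rw [hqa]; ring)
  rw [hsa, h.travelTime_advance, ← hsa] at hdrop
  have hTb := h.travelTime_advance (freq α α') ![a + 1 / (2 * q n), y, z] (exp (q' n))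
  rw [← hsb] at hTb
  have hmain : (q n : ℝ) / 3 ≤ q n * exp (-(q' n : ℝ)) * sa := by
    calc (q n : ℝ) / 3 = q n * (exp (-(q' n : ℝ)) * exp (q' n)) / 3 := by
          rw [← exp_add, neg_add_cancel, exp_zero, mul_one]
      _ = q n * exp (-(q' n : ℝ)) * (exp (q' n) / 3) := by ring
      _ ≤ _ := by gcongr
  rcases le_total sa sb with hle | hle
  · have := (h.travelTime_sub_mem (freq α α') ![a + 1 / (2 * q n), y, z] hle).2
    linarith
  · have := (h.travelTime_sub_mem (freq α α') ![a + 1 / (2 * q n), y, z] hle).1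
    linarith

/-- In a window of `θ₁` of length `2 / qₙ³`, the length covered is almost constant. -/
theorem abs_advance_sub_le (n : ℕ) {x x₀ : ℝ} (hx : |x - x₀| ≤ 2 / (q n : ℝ) ^ 3) (y z : ℝ) :
    |advance p q q' (freq α α') ![x, y, z] (exp (q' n)) -
      advance p q q' (freq α α') ![x₀, y, z] (exp (q' n))| ≤
      10 * π * (nonresonantBound q' + 3) / q n := by
  have hq : (0 : ℝ) < q n := zero_lt_one.trans_le (h.one_le n)
  have hD := nonresonantBound_nonneg q'
  obtain ⟨hs1, hs2⟩ := h.advance_mem (freq α α') ![x, y, z] (exp_pos (q' n))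
  have h1 := h.abs_travelTime_sub_le n (by linarith [exp_pos (q' n : ℝ)]) hs2 x x₀ y z
  have h2 := h.abs_sub_le_travelTime (freq α α') ![x₀, y, z]
    (advance p q q' (freq α α') ![x₀, y, z] (exp (q' n)))
    (advance p q q' (freq α α') ![x, y, z] (exp (q' n)))
  rw [h.travelTime_advance] at h1 h2
  have h3 : 2 * π * |x₀ - x| * ((nonresonantBound q' + 3) * (q n : ℝ) ^ 2) ≤
      2 * π * (2 / (q n : ℝ) ^ 3) * ((nonresonantBound q' + 3) * (q n : ℝ) ^ 2) := by
    rw [abs_sub_comm]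
    gcongr
  have h4 : 2 * π * (2 / (q n : ℝ) ^ 3) * ((nonresonantBound q' + 3) * (q n : ℝ) ^ 2) =
      2 / 5 * (10 * π * (nonresonantBound q' + 3) / q n) := by
    field_simp
    ring
  linarith

/-- Within a window of `θ₁` of length `2 / qₙ³`, the displacement of `r₁` takes all prescribed
values: the window contains a full period of the `n`-th resonance of `h̃`. -/
theorem exists_integral_levelForce_zero_eq (c R : ℝ) {n : ℕ}
    (hn : 3 * (q' n * exp (-(q' n : ℝ))) ≤ 1 / 6)
    (hbig : 2 * π * (|c| * (nonresonantBound q' + 3) + nonresonantBound q') * (q n : ℝ) ^ 2 + |R| ≤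
      (q n : ℝ) ^ 5) (x₀ y z : ℝ) :
    ∃ x, x₀ ≤ x ∧ x ≤ x₀ + 2 / (q n : ℝ) ^ 3 ∧
      ∫ u in (0 : ℝ)..advance p q q' (freq α α') ![x, y, z] (exp (q' n)),
        levelForce p p' q q' c 0 (![x, y, z] + u • freq α α') = R := by
  have hq : (0 : ℝ) < q n := zero_lt_one.trans_le (h.one_le n)
  set F : ℝ → ℝ := fun x => ∫ u in (0 : ℝ)..advance p q q' (freq α α') ![x, y, z] (exp (q' n)),
        levelForce p p' q q' c 0 (![x, y, z] + u • freq α α') with hF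
  have hFc : Continuous F := by
    have hcurve : Continuous fun x : ℝ => (![x, y, z] : Fin 3 → ℝ) := by fun_prop
    exact (h.continuous_integral_levelForce c 0 (freq α α')
      (h.continuous_advance (freq α α') (exp (q' n)))).comp hcurve
  set G : ℝ → ℝ := fun x => osc ((q n : ℝ) ^ 2 * (q n * x - p n * z) + 1 / 4)
    ((q n : ℝ) ^ 2 * (q n * α - p n)) (advance p q q' (freq α α') ![x, y, z] (exp (q' n))) with hG
  have hest : ∀ x, |F x - 2 * π * ((q n : ℝ) ^ 5 * exp (-(q' n : ℝ))) * G x| ≤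
      2 * π * (|c| * (nonresonantBound q' + 3) + nonresonantBound q') * (q n : ℝ) ^ 2 := fun x => by
    obtain ⟨hs1, hs2⟩ := h.advance_mem (freq α α') ![x, y, z] (exp_pos (q' n))
    exact h.abs_integral_levelForce_zero_sub_le c n (by linarith [exp_pos (q' n : ℝ)]) hs2 x y z
  have hcrest : ∀ (x : ℝ) (i : ℤ), exp (q' n) / 6 ≤
      osc i ((q n : ℝ) ^ 2 * (q n * α - p n))
        (advance p q q' (freq α α') ![x, y, z] (exp (q' n))) := fun x i => by
    obtain ⟨hs1, hs2⟩ := h.advance_mem (freq α α') ![x, y, z] (exp_pos (q' n))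
    have hs0 : 0 ≤ advance p q q' (freq α α') ![x, y, z] (exp (q' n)) := by
      linarith [exp_pos (q' n : ℝ)]
    have := half_le_osc_int i hs0 (h.abs_mul_approx_le hn hs0 hs2 (sq_nonneg (q n : ℝ))
      (h.pow_le_of_le_four n (by norm_num)))
    linarith
  have hamp : (q n : ℝ) ^ 5 ≤ 2 * π * ((q n : ℝ) ^ 5 * exp (-(q' n : ℝ))) * (exp (q' n) / 6) := by
    have e : 2 * π * ((q n : ℝ) ^ 5 * exp (-(q' n : ℝ))) * (exp (q' n) / 6) =
        π / 3 * (q n : ℝ) ^ 5 * (exp (-(q' n : ℝ)) * exp (q' n)) := by ring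
    rw [e, ← exp_add, neg_add_cancel, exp_zero, mul_one]
    exact le_mul_of_one_le_left (by positivity) (by linarith [pi_gt_three])
  set i := ⌈(q n : ℝ) ^ 2 * (q n * x₀ - p n * z) + 1 / 4⌉ with hi
  have h1 : (q n : ℝ) ^ 2 * (q n * x₀ - p n * z) + 1 / 4 ≤ i := Int.le_ceil _
  have h2 : (i : ℝ) < (q n : ℝ) ^ 2 * (q n * x₀ - p n * z) + 1 / 4 + 1 := Int.ceil_lt_add_one _
  have hq3 : (0 : ℝ) < (q n : ℝ) ^ 3 := by positivity
  set a := (i - 1 / 4 + (q n : ℝ) ^ 2 * (p n * z)) / (q n : ℝ) ^ 3 with ha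
  set b := a + 1 / (2 * (q n : ℝ) ^ 3) with hb
  have hqa : (q n : ℝ) ^ 3 * a = i - 1 / 4 + (q n : ℝ) ^ 2 * (p n * z) := by rw [ha]; field_simp
  have hqb : (q n : ℝ) ^ 3 * b = i + 1 / 4 + (q n : ℝ) ^ 2 * (p n * z) := by
    rw [hb, mul_add, hqa]
    field_simp
    ring
  have hGa : exp (q' n) / 6 ≤ G a := by
    have e : (q n : ℝ) ^ 2 * (q n * a - p n * z) + 1 / 4 = i := by linear_combination hqa
    rw [hG]
    simp only
    rw [e]
    exact hcrest a i
  have hGb : exp (q' n) / 6 ≤ -G b := by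
    have e : (q n : ℝ) ^ 2 * (q n * b - p n * z) + 1 / 4 = i + 1 / 2 := by linear_combination hqb
    rw [hG]
    simp only
    rw [e, osc_add_half, neg_neg]
    exact hcrest b i
  have hab : a ≤ b := by linarith [show (0 : ℝ) < 1 / (2 * (q n : ℝ) ^ 3) by positivity]
  have hx₀a : x₀ ≤ a := le_of_mul_le_mul_left (by rw [hqa]; linarith) hq3
  have hbx₀ : b ≤ x₀ + 2 / (q n : ℝ) ^ 3 := by
    refine le_of_mul_le_mul_left ?_ hq3
    rw [hqb, mul_add, mul_div_cancel₀ _ hq3.ne']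
    linarith
  have hR := abs_le.1 (le_refl |R|)
  have hcoef : 0 ≤ 2 * π * ((q n : ℝ) ^ 5 * exp (-(q' n : ℝ))) := by positivity
  have hFa : R ≤ F a := by
    have := (abs_le.1 (hest a)).1
    have := hamp.trans (mul_le_mul_of_nonneg_left hGa hcoef)
    linarith
  have hFb : F b ≤ R := by
    have := (abs_le.1 (hest b)).2
    have := hamp.trans (mul_le_mul_of_nonneg_left hGb hcoef)
    linarith
  obtain ⟨x, hx, hxR⟩ := intermediate_value_Icc' hab hFc.continuousOn ⟨hFb, hFa⟩
  exact ⟨x, hx₀a.trans hx.1, hx.2.trans hbx₀, hxR⟩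

theorem exists_integral_levelForce_one_eq (c R : ℝ) {K₀ K n : ℕ} (hK : K₀ ≤ K) (hKn : K ≤ n)
    {s : ℝ} (hs : 0 ≤ s) (hs' : s ≤ 3 * exp (q' n))
    (hsin : 1 / 2 ≤ |sin (π * ((q' K * α' - p' K) * s))|)
    (hbig : |R| ≤ (q' K : ℝ) / 2 - (∑ k ∈ Finset.range K₀,
      2 * (q' k * exp (-(q' k : ℝ)) / |q' k * α' - p' k|)) - 2 * π * nonresonantBound q')
    (x y₀ z : ℝ) :
    ∃ y, y₀ ≤ y ∧ y ≤ y₀ + 2 / q' K₀ ∧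
      ∫ u in (0 : ℝ)..s, levelForce p p' q q' c 1 (![x, y, z] + u • freq α α') = R := by
  set F : ℝ → ℝ := fun y => ∫ u in (0 : ℝ)..s,
    levelForce p p' q q' c 1 (![x, y, z] + u • freq α α') with hF
  have hFc : Continuous F := by
    have hcurve : Continuous fun y : ℝ => (![x, y, z] : Fin 3 → ℝ) := by fun_prop
    exact (h.continuous_integral_levelForce c 1 (freq α α')
      (continuous_const (y := s))).comp hcurve
  obtain ⟨a, ha1, ha2, ha3⟩ := h.exists_le_integral_levelForce_one c hK hKn hs hs' hsin x y₀ z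
    (σ := -1) (by simp)
  obtain ⟨b, hb1, hb2, hb3⟩ := h.exists_le_integral_levelForce_one c hK hKn hs hs' hsin x y₀ z
    (σ := 1) (by simp)
  have hR := abs_le.1 hbig
  have hRab : R ∈ Set.uIcc (F a) (F b) := by
    refine Set.mem_uIcc_of_le ?_ ?_ <;> simp only [hF] <;> linarith
  obtain ⟨y, hy, hyR⟩ := intermediate_value_uIcc hFc.continuousOn hRab
  have hsub := Set.uIcc_subset_Icc (⟨ha1, ha2⟩ : a ∈ Set.Icc y₀ (y₀ + 2 / q' K₀)) ⟨hb1, hb2⟩ hy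
  exact ⟨y, hsub.1, hsub.2, hyR⟩

theorem exists_syndetic_freq {ε : ℝ} (hε : 0 < ε) :
    ∃ L : ℝ, ∀ (v : Fin 3 → ℝ) (T : ℝ), ∃ s, T ≤ s ∧ s ≤ T + L ∧
      ∃ k : Fin 3 → ℤ, ∀ j, |s * freq α α' j - v j - k j| < ε := by
  refine exists_syndetic_linearFlow (fun m hm => ?_) hε
  have := h.int_combination_ne_zero m hm
  simpa [Fin.sum_univ_three, freq] using this

/-- The explicit solution, read on the energy surface: it suffices to know the displacements of
`r₁` and `r₂`. -/
theorem flow_surfaceAction {Φ : ℝ → Phase → Phase}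
    (hΦ : IsHamiltonianFlow (tildeH α α' p p' q q') Φ) (c a b : ℝ) (θ : Fin 3 → ℝ) {s t : ℝ}
    (ht : travelTime p q q' (freq α α') θ s = t) :
    Φ t (toTorus θ, surfaceAction α α' p p' q q' c a b θ) =
      (toTorus (θ + s • freq α α'), surfaceAction α α' p p' q q' c
        (a + ∫ u in (0 : ℝ)..s, levelForce p p' q q' c 0 (θ + u • freq α α'))
        (b + ∫ u in (0 : ℝ)..s, levelForce p p' q q' c 1 (θ + u • freq α α'))
        (θ + s • freq α α')) := by
  have hE : tildeH α α' p p' q q' (θ, surfaceAction α α' p p' q q' c a b θ) = c :=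
    (h.tildeH_eq_iff_surfaceAction c θ _).2 (by simp [surfaceAction])
  have h1 := h.tildeH_orbit θ (surfaceAction α α' p p' q q' c a b θ) s
  rw [hE] at h1
  have h2 := (h.tildeH_eq_iff_surfaceAction c _ _).1 h1
  rw [← ht, h.flow_travelTime hΦ]
  refine Prod.ext rfl (h2.trans ?_)
  rw [hE]
  simp only [surfaceAction, Matrix.cons_val]

/-- If the flow brings the angles close to a point at which the `K`-th resonance is half a turn out
of phase with the starting point, then `(q'_K α' - p'_K) s` is far from the integers. -/
theorem half_le_abs_sin_arrival {K : ℕ} {y yB d s s₀ ε : ℝ} {i : ℤ} {m₁ m₂ : ℤ}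
    (hphase : q' K * (yB - y) - p' K * d = i + 1 / 2)
    (hε : ((q' K : ℝ) + |(p' K : ℝ)|) * ε ≤ 1 / 8) (h₁ : |s₀ * α' - (yB - y) - m₁| ≤ ε)
    (h₂ : |s₀ - d - m₂| ≤ ε) (hs : |s - s₀| ≤ 1 / 8) :
    1 / 2 ≤ |sin (π * ((q' K * α' - p' K) * s))| := by
  have hδ : |q' K * α' - p' K| ≤ 1 :=
    (h.approx' K).trans (exp_le_one_iff.2 (by linarith [h.one_le' K]))
  have e : (q' K * α' - p' K) * s - (q' K * m₁ - p' K * m₂ + i : ℤ) - 1 / 2 =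
      (q' K * α' - p' K) * (s - s₀) + (q' K * (s₀ * α' - (yB - y) - m₁) -
        p' K * (s₀ - d - m₂)) := by
    push_cast
    linear_combination hphase
  refine half_le_abs_sin_of_abs_sub_le (i := q' K * m₁ - p' K * m₂ + i) ?_
  rw [e]
  have h1 : |(q' K * α' - p' K) * (s - s₀)| ≤ 1 / 8 := by
    rw [abs_mul]
    nlinarith [abs_nonneg (q' K * α' - p' K), abs_nonneg (s - s₀)]
  have h2 : |q' K * (s₀ * α' - (yB - y) - m₁) - p' K * (s₀ - d - m₂)| ≤ 1 / 8 := by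
    refine (abs_sub _ _).trans (le_trans ?_ hε)
    rw [abs_mul, abs_mul, Nat.abs_cast, add_mul]
    gcongr
  exact (abs_add_le _ _).trans (by linarith)

theorem weaklyMixingAlong {Φ : ℝ → Phase → Phase}
    (hΦ : IsHamiltonianFlow (tildeH α α' p p' q q') Φ) :
    WeaklyMixingAlong (tildeH α α' p p' q q') Φ fun n => exp (q' n : ℝ) := by
  intro c A B hA hB hAne hBne
  obtain ⟨θA, a₁, a₂, εA, hεA, hA'⟩ := h.exists_mem_of_isRelOpen hA hAne
  obtain ⟨θB, b₁, b₂, εB, hεB, hB'⟩ := h.exists_mem_of_isRelOpen hB hBne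
  obtain ⟨ρ, hρ, hρA, hρB⟩ : ∃ ρ > 0, 4 * ρ ≤ εA ∧ 4 * ρ ≤ εB := by
    refine ⟨min εA εB / 4, by positivity, ?_, ?_⟩
    · linarith [min_le_left εA εB]
    · linarith [min_le_right εA εB]
  have hD := nonresonantBound_nonneg q'
  set D := nonresonantBound q'
  -- The index `K₀` makes a full period in `θ₂` short.
  obtain ⟨K₀, hK₀⟩ := (h.tendsto_q'.eventually_ge_atTop (2 / ρ)).exists
  have hK₀ρ : 2 / (q' K₀ : ℝ) ≤ ρ := by
    have h1 := h.one_le' K₀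
    rw [div_le_iff₀ hρ] at hK₀
    rw [div_le_iff₀ (by linarith)]
    linarith
  set C₀ := ∑ k ∈ Finset.range K₀, 2 * (q' k * exp (-(q' k : ℝ)) / |q' k * α' - p' k|) with hC₀
  -- The `K`-th resonance moves `r₂` by enough, provided that it is out of phase at the arrival.
  obtain ⟨K, hK, hKbig, hKρ⟩ := ((eventually_ge_atTop K₀).and
    ((h.tendsto_q'.eventually_ge_atTop (2 * (|b₂ - a₂| + C₀ + 2 * π * D))).and
      (h.tendsto_q'.eventually_ge_atTop (1 / ρ)))).exists
  have hqK := h.one_le' K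
  have hqK0 : (0 : ℝ) < q' K := by linarith
  have hKρ' : 1 / (q' K : ℝ) ≤ ρ := by
    rw [div_le_iff₀ hρ] at hKρ
    rw [div_le_iff₀ hqK0]
    linarith
  obtain ⟨yB, i, hqyB, hyB⟩ := exists_half_turn hqK0 (p' K) (θA 1) (θB 1) (θB 2 - θA 2)
  have hyBρ : |yB - θB 1| ≤ ρ := hyB.trans hKρ'
  obtain ⟨ε, hε, hερ, hεK⟩ : ∃ ε > 0, ε ≤ ρ ∧ ((q' K : ℝ) + |(p' K : ℝ)|) * ε ≤ 1 / 8 := by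
    have hpos : 0 < (q' K : ℝ) + |(p' K : ℝ)| := by positivity
    refine ⟨min ρ (1 / 8 / ((q' K : ℝ) + |(p' K : ℝ)|)), by positivity, min_le_left _ _, ?_⟩
    rw [← le_div_iff₀' hpos]
    exact min_le_right _ _
  obtain ⟨L, hL⟩ := h.exists_syndetic_freq hε
  have hL0 : 0 ≤ L := by
    obtain ⟨s, hs1, hs2, _⟩ := hL 0 0
    linarith
  set C₁ := 2 * π * (|c| * (D + 3) + D) with hC₁
  have hC₁0 : 0 ≤ C₁ := by positivity
  have hsmall : ∀ᶠ n in atTop, 3 * (q' n * exp (-(q' n : ℝ))) ≤ 1 / 6 := by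
    have h1 := ((tendsto_pow_mul_exp_neg_atTop_nhds_zero 1).comp h.tendsto_q').const_mul 3
    rw [mul_zero] at h1
    filter_upwards [h1.eventually (gt_mem_nhds (by norm_num : (0 : ℝ) < 1 / 6))] with n hn
    simpa using hn.le
  have hshift : ∀ᶠ n in atTop,
      10 * π * (D + 3) / q n ≤ min (1 / 8) (ρ / (1 + |α| + |α'|)) := by
    have h1 : Tendsto (fun n => 10 * π * (D + 3) / (q n : ℝ)) atTop (𝓝 0) :=
      tendsto_const_nhds.div_atTop h.tendsto_q
    exact (h1.eventually (gt_mem_nhds (by positivity))).mono fun n hn => hn.le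
  obtain ⟨N, hN⟩ := eventually_atTop.1 ((eventually_ge_atTop K).and (hsmall.and (hshift.and
    ((h.tendsto_q.eventually_ge_atTop (5 * L + 4 * (π * D) + 1)).and
      ((h.tendsto_q.eventually_ge_atTop (C₁ + |b₁ - a₁|)).and
        (h.tendsto_q.eventually_ge_atTop (4 / ρ)))))))
  refine ⟨N, fun n hnN => ?_⟩
  obtain ⟨hKn, hn, hη, hLn, hRn, hρn⟩ := hN n hnN
  have hq := h.one_le n
  have hq0 : (0 : ℝ) < q n := by linarith
  set t := exp (q' n : ℝ) with ht
  have ht0 : 0 < t := exp_pos _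
  -- Choose `θ₁` so that the angles arrive near `θB`, with `yB` in place of its second coordinate.
  obtain ⟨a, b, hxa, hab, hbx, hadv⟩ := h.exists_advance_add_le hn hL0 hLn (θA 0) (θA 1) (θA 2)
  obtain ⟨s₀, hs₀1, hs₀2, k, hk⟩ := hL (![θB 0, yB, θB 2] - θA)
    (advance p q q' (freq α α') ![a, θA 1, θA 2] t)
  have hcurve : Continuous fun x : ℝ => advance p q q' (freq α α') ![x, θA 1, θA 2] t := by
    have : Continuous fun x : ℝ => (![x, θA 1, θA 2] : Fin 3 → ℝ) := by fun_prop
    exact (h.continuous_advance (freq α α') t).comp this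
  obtain ⟨x₀, hx₀, hx₀s⟩ := intermediate_value_Icc hab hcurve.continuousOn
    (⟨hs₀1, hs₀2.trans hadv⟩ : s₀ ∈ Set.Icc _ _)
  simp only at hx₀s
  -- Adjust `θ₁` to reach `b₁`.
  obtain ⟨x, hx1, hx2, hxR⟩ := h.exists_integral_levelForce_zero_eq (p' := p') c (b₁ - a₁) hn (by
    have h1 : C₁ * (q n : ℝ) ^ 2 + |b₁ - a₁| ≤ (C₁ + |b₁ - a₁|) * (q n : ℝ) ^ 2 := by
      nlinarith [abs_nonneg (b₁ - a₁), one_le_pow₀ hq (n := 2)]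
    have h2 : (C₁ + |b₁ - a₁|) * (q n : ℝ) ^ 2 ≤ q n * (q n : ℝ) ^ 2 := by gcongr
    have h3 : (q n : ℝ) ^ 3 ≤ (q n : ℝ) ^ 5 := pow_le_pow_right₀ hq (by norm_num)
    linarith [pow_succ' (q n : ℝ) 2]) x₀ (θA 1) (θA 2)
  set s := advance p q q' (freq α α') ![x, θA 1, θA 2] t with hs
  have hss₀ : |s - s₀| ≤ 10 * π * (D + 3) / q n := by
    rw [← hx₀s]
    exact h.abs_advance_sub_le n (abs_le.2 ⟨by linarith [show 0 < 2 / (q n : ℝ) ^ 3 by positivity],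
      by linarith⟩) (θA 1) (θA 2)
  obtain ⟨hst1, hst2⟩ := h.advance_mem (freq α α') ![x, θA 1, θA 2] ht0
  rw [← hs] at hst1 hst2
  have hsin : 1 / 2 ≤ |sin (π * ((q' K * α' - p' K) * s))| := by
    have hk1 := hk 1
    have hk2 := hk 2
    simp only [freq, Pi.sub_apply, Matrix.cons_val, mul_one] at hk1 hk2
    exact h.half_le_abs_sin_arrival hqyB hεK hk1.le hk2.le (hss₀.trans (hη.trans (min_le_left _ _)))
  -- Adjust `θ₂`, which does not influence the rest, to reach `b₂`.
  obtain ⟨y, hy1, hy2, hyR⟩ := h.exists_integral_levelForce_one_eq c (b₂ - a₂) hK hKn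
    (by linarith) hst2 hsin (by linarith) x (θA 1) (θA 2)
  have hT : travelTime p q q' (freq α α') ![x, y, θA 2] s = t := by
    rw [h.travelTime_congr x y (θA 1), hs, h.travelTime_advance]
  rw [← h.integral_levelForce_zero_congr (p' := p') c x y (θA 1)] at hxR
  have hflow := h.flow_surfaceAction hΦ c a₁ a₂ ![x, y, θA 2] hT
  rw [hxR, hyR, add_sub_cancel, add_sub_cancel] at hflow
  have hxA : |x - θA 0| ≤ ρ := by
    have h1 : 2 / (q n : ℝ) ^ 3 ≤ 2 / q n := by
      gcongr
      exact le_self_pow₀ hq (by norm_num)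
    have h2 : 4 / (q n : ℝ) ≤ ρ := by
      rw [div_le_iff₀ hρ] at hρn
      rw [div_le_iff₀ hq0]
      linarith
    have h3 : 4 / (q n : ℝ) = 2 / q n + 2 / q n := by ring
    rw [abs_of_nonneg (by linarith [hx₀.1])]
    linarith [hx₀.2]
  have hyA : |y - θA 1| ≤ ρ := by
    rw [abs_of_nonneg (by linarith)]
    linarith
  refine ⟨_, ⟨_, hA' ![x, y, θA 2] fun j => ?_, rfl⟩, ?_⟩
  · fin_cases j
    · exact (hxA.trans_lt (by linarith))
    · exact (hyA.trans_lt (by linarith))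
    · simpa using hεA
  · change Φ t _ ∈ B
    rw [hflow]
    set θ : Fin 3 → ℝ := fun j => (![x, y, θA 2] + s • freq α α') j - k j with hθ
    have hback : ![x, y, θA 2] + s • freq α α' = fun j => θ j + k j := by
      ext j
      simp [hθ]
    rw [hback, surfaceAction_add_int, toTorus_eq_iff.2 ⟨k, rfl⟩]
    refine hB' θ fun j => ?_
    have hw : |(s - s₀) * freq α α' j| ≤ ρ := by
      have h1 := hss₀.trans (hη.trans (min_le_right _ _))
      have h2 : |freq α α' j| ≤ 1 + |α| + |α'| := by
        have := abs_nonneg α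
        have := abs_nonneg α'
        fin_cases j <;> simp [freq] <;> linarith
      rw [abs_mul]
      calc _ ≤ ρ / (1 + |α| + |α'|) * (1 + |α| + |α'|) := by gcongr
        _ = ρ := by field_simp
    have hkj := (hk j).trans_le hερ
    have hstart : |![x, y, θA 2] j - θA j| ≤ ρ := by
      fin_cases j
      · exact hxA
      · exact hyA
      · simpa using hρ.le
    have hend : |![θB 0, yB, θB 2] j - θB j| ≤ ρ := by
      fin_cases j
      · simpa using hρ.le
      · exact hyBρ
      · simpa using hρ.le
    have e : θ j - θB j = (![x, y, θA 2] j - θA j) + (s - s₀) * freq α α' j +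
        (s₀ * freq α α' j - (![θB 0, yB, θB 2] - θA) j - k j) +
        (![θB 0, yB, θB 2] j - θB j) := by
      simp only [hθ, Pi.add_apply, Pi.smul_apply, Pi.sub_apply, smul_eq_mul]
      ring
    rw [e]
    exact (abs_add_four_lt hstart hw hkj hend).trans_le hρB

end LiouvillePair

theorem mainTheorem4 (α α' : ℝ) (p p' : ℕ → ℤ) (q q' : ℕ → ℕ)
    (hq_pos : ∀ n, 1 ≤ q n) (hq'_pos : ∀ n, 1 ≤ q' n)
    (hcop : ∀ n, IsCoprime (p n) (q n : ℤ)) (hcop' : ∀ n, IsCoprime (p' n) (q' n : ℤ))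
    (hq_mono : StrictMono q)
    (hqq' : ∀ n, q n ^ 4 ≤ q' n)
    (hα : ∀ n, |q n * α - p n| ≤ Real.exp (-(2 * q' n : ℝ)))
    (hα' : ∀ n, |q' n * α' - p' n| ≤ Real.exp (-(q' n : ℝ))) :
    (∀ θ, Summable (fun n => phiTerm p q q' n θ) ∧ Summable (fun n => hTerm p q q' n θ) ∧
      Summable (fun n => hTerm' p' q' n θ) ∧ 0 < phi p q q' θ) ∧
    ContDiff ℝ ∞ (tildeH α α' p p' q q') ∧
    (∃ Φ, IsHamiltonianFlow (tildeH α α' p p' q q') Φ) ∧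
    ∀ Φ, IsHamiltonianFlow (tildeH α α' p p' q q') Φ →
      TopologicallyWeaklyMixing (tildeH α α' p p' q q') Φ ∧
      WeaklyMixingAlong (tildeH α α' p p' q q') Φ (fun n => Real.exp (q' n : ℝ)) := by
  have h : LiouvillePair α α' p p' q q' :=
    ⟨hq_pos, hq'_pos, hcop, hcop', hq_mono, hqq', hα, hα'⟩
  exact ⟨fun θ => ⟨h.summable_phiTerm θ, h.summable_hTerm θ, h.summable_hTerm' θ, h.phi_pos θ⟩,
    h.contDiff_tildeH, h.exists_isHamiltonianFlow,
    fun Φ hΦ => ⟨⟨_, h.weaklyMixingAlong hΦ⟩, h.weaklyMixingAlong hΦ⟩⟩
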